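/- **Notation.** All manifolds, metrics and functions are smooth, and manifolds are non-empty, without boundary and finite-dimensional. Let $(N,h)$ be a pseudo-Riemannian manifold of dimension $m$ with Levi-Civita connection $\nabla$, Ricci tensor $R_{\alpha\beta}$, scalar curvature $R$ and Weyl conformal curvature tensor $\mathcal C_{\alpha\beta\gamma}{}^{\varepsilon}$ (understood to be zero if $m\le 2$). $(N,h)$ is an Einstein-like manifold *of class $\mathcal I\oplus\mathcal B$* if the tensor $$\mathcal H_{\alpha\beta}=R_{\alpha\beta}-\frac{R}{2(m-1)}\,h_{\alpha\beta}$$ (understood to be zero if $m\le 1$) is a Codazzi tensor, that is, $\nabla_\gamma\mathcal H_{\alpha\beta}=\nabla_\alpha\mathcal H_{\gamma\beta}$. (For $m\ge 4$ this means that the Weyl tensor is harmonic, $\nabla_\varepsilon\mathcal C_{\alpha\beta\gamma}{}^{\varepsilon}=0$.) **Theorem.** Let $(M_1,g_1)$ and $(M_2,g_2)$ be pseudo-Riemannian manifolds, let $f_i:M_i\to(0,\infty)$ for $i=1,2$, and let $M={}_{f_2}M_1\times_{f_1}M_2$ be the doubly warped product, that is, $M_1\times M_2$ with the metric $$g=(f_2\circ\pi_2)^2\,\pi_1^*g_1+(f_1\circ\pi_1)^2\,\pi_2^*g_2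 ,$$ where $\pi_i:M_1\times M_2\to M_i$ are the projections. Assume that $(M,g)$ is of class $\mathcal I\oplus\mathcal B$ and that $$\nabla_\varepsilon(f_1f_2)\,\mathcal C_{\alpha\beta\gamma}{}^{\varepsilon}=0 \quad\text{on } M,$$ where $\mathcal C$ is the Weyl tensor of $(M,g)$ and $f_1f_2=(f_1\circ\pi_1)(f_2\circ\pi_2)$. Then for each $i=1,2$: if the conformally changed metric $f_i^{-2}g_i$ on $M_i$ has constant scalar curvature, then $$(M_i,g_i)\text{ is of class }\mathcal I\oplus\mathcal B\quad\Longleftrightarrow\quad(\nabla^i_\varepsilon f_i)\,\mathcal C^{i}{}_{\alpha\beta\gamma}{}^{\varepsilon}=0\ \text{ on } M_i,$$ where $\nabla^i$ and $\mathcal C^i$ are the Levi-Civita connection and the Weyl tensor of $(M_i,g_i)$. -/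

import Mathlib

open scoped Manifold ContDiff Bundle

set_option maxSynthPendingDepth 3

noncomputable section

/-! ### Curvature of a metric on an open set of a vector space

`G : E → E →L[ℝ] E →L[ℝ] ℝ` is a field of bilinear forms on a finite-dimensional real vector
space `E` (the expression of a pseudo-Riemannian metric in a chart). Contractions and traces are
basis-free, so these are the usual coordinate formulas. -/

namespace LocalMetric

variable {E : Type*} [NormedAddCommGroup E] [NormedSpace ℝ E]

/-- The pullback `(u, v) ↦ b(L u, L v)` of a bilinear form `b` under a linear map `L`. -/
def pullback {E F : Type*} [NormedAddCommGroup E] [NormedSpace ℝ E]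
    [NormedAddCommGroup F] [NormedSpace ℝ F] (b : F →L[ℝ] F →L[ℝ] ℝ) (L : E →L[ℝ] F) :
    E →L[ℝ] E →L[ℝ] ℝ :=
  b.bilinearComp L L

/-- The Christoffel symbols of the first kind, as a trilinear form:
`½ (∂_u G(v, w) + ∂_v G(u, w) - ∂_w G(u, v))`; see `koszul_apply`. -/
def koszul (G : E → E →L[ℝ] E →L[ℝ] ℝ) (y : E) : E →L[ℝ] E →L[ℝ] E →L[ℝ] ℝ :=
  let D : E →L[ℝ] E →L[ℝ] E →L[ℝ] ℝ := fderiv ℝ G y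
  let T : E →L[ℝ] E →L[ℝ] E →L[ℝ] ℝ :=
    (ContinuousLinearMap.flipₗᵢ ℝ E E ℝ).toContinuousLinearEquiv.toContinuousLinearMap.comp D.flip
  (1 / 2 : ℝ) • (D + D.flip - T)

theorem koszul_apply (G : E → E →L[ℝ] E →L[ℝ] ℝ) (y u v w : E) :
    koszul G y u v w
      = (1 / 2 : ℝ) * (fderiv ℝ G y u v w + fderiv ℝ G y v u w - fderiv ℝ G y w u v) := by
  simp [koszul]

/-- The Christoffel symbols of the second kind `Γ(u, v)`: the index `w` of `koszul` raised with
the inverse of the metric. -/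
def christoffel (G : E → E →L[ℝ] E →L[ℝ] ℝ) (y : E) : E →L[ℝ] E →L[ℝ] E :=
  (ContinuousLinearMap.compL ℝ E (E →L[ℝ] ℝ) E (G y).inverse).comp (koszul G y)

theorem christoffel_apply (G : E → E →L[ℝ] E →L[ℝ] ℝ) (y u v : E) :
    christoffel G y u v = (G y).inverse (koszul G y u v) := by
  simp [christoffel]

/-- The part of the Riemann tensor that has to be antisymmetrized:
`(u, v, w) ↦ (∂_u Γ)(v, w) + Γ(u, Γ(v, w))`. -/
def riemannAux (G : E → E →L[ℝ] E →L[ℝ] ℝ) (y : E) : E →L[ℝ] E →L[ℝ] E →L[ℝ] E :=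
  fderiv ℝ (christoffel G) y
    + (ContinuousLinearMap.compL ℝ E E E).bilinearComp (christoffel G y) (christoffel G y)

/-- The Riemann tensor `R(u, v) w = ∇_u ∇_v w - ∇_v ∇_u w - ∇_[u,v] w`; see `riemann_apply`. -/
def riemann (G : E → E →L[ℝ] E →L[ℝ] ℝ) (y : E) : E →L[ℝ] E →L[ℝ] E →L[ℝ] E :=
  riemannAux G y - (riemannAux G y).flip

theorem riemann_apply (G : E → E →L[ℝ] E →L[ℝ] ℝ) (y u v w : E) :
    riemann G y u v w
      = fderiv ℝ (christoffel G) y u v w - fderiv ℝ (christoffel G) y v u w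
        + christoffel G y u (christoffel G y v w) - christoffel G y v (christoffel G y u w) := by
  simp [riemann, riemannAux]
  abel

variable [FiniteDimensional ℝ E]

/-- The trace of an endomorphism, as a continuous linear form. -/
def traceCLM : (E →L[ℝ] E) →L[ℝ] ℝ :=
  LinearMap.toContinuousLinearMap ((LinearMap.trace ℝ E).comp (ContinuousLinearMap.coeLM ℝ))

theorem traceCLM_apply (A : E →L[ℝ] E) : traceCLM A = LinearMap.trace ℝ E (A : E →ₗ[ℝ] E) := rfl

/-- The Ricci tensor `Ric(v, w) = tr (u ↦ R(u, v) w)`; see `ricci_apply`. -/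
def ricci (G : E → E →L[ℝ] E →L[ℝ] ℝ) (y : E) : E →L[ℝ] E →L[ℝ] ℝ :=
  (ContinuousLinearMap.compL ℝ E (E →L[ℝ] E) ℝ traceCLM).comp
    ((ContinuousLinearMap.flipₗᵢ ℝ E E E : (E →L[ℝ] E →L[ℝ] E) →L[ℝ] (E →L[ℝ] E →L[ℝ] E)).comp
      (riemann G y).flip)

theorem ricci_apply (G : E → E →L[ℝ] E →L[ℝ] ℝ) (y v w : E) :
    ricci G y v w
      = LinearMap.trace ℝ E ((((riemann G y).flip v).flip w : E →L[ℝ] E) : E →ₗ[ℝ] E) := rfl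

/-- The Ricci tensor with one index raised. -/
def ricciSharp (G : E → E →L[ℝ] E →L[ℝ] ℝ) (y : E) : E →L[ℝ] E :=
  (G y).inverse.comp (ricci G y)

/-- The scalar curvature: the trace of the Ricci tensor with respect to the metric. -/
def scalar (G : E → E →L[ℝ] E →L[ℝ] ℝ) (y : E) : ℝ :=
  LinearMap.trace ℝ E (ricciSharp G y : E →ₗ[ℝ] E)

/-- The tensor `H = Ric - R / (2 (n - 1)) g`, where `n = dim E` and `R` is the scalar curvature.
(For `n = 1` both `Ric` and `R` vanish, and `H = 0`.) -/
def hTensor (G : E → E →L[ℝ] E →L[ℝ] ℝ) (y : E) : E →L[ℝ] E →L[ℝ] ℝ :=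
  ricci G y - (scalar G y / (2 * ((Module.finrank ℝ E : ℝ) - 1))) • G y

/-- The covariant derivative `(∇_u T)(v, w)` of a field `T` of bilinear forms, with respect to the
Levi-Civita connection of `G`. -/
def covDeriv (G T : E → E →L[ℝ] E →L[ℝ] ℝ) (y u v w : E) : ℝ :=
  fderiv ℝ T y u v w - T y (christoffel G y u v) w - T y v (christoffel G y u w)

/-- The Weyl conformal curvature tensor `C(u, v) w`, with the usual convention that it is zero
in dimension at most two. -/
def weyl (G : E → E →L[ℝ] E →L[ℝ] ℝ) (y u v w : E) : E :=
  let n : ℝ := Module.finrank ℝ E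
  if Module.finrank ℝ E ≤ 2 then 0 else
    riemann G y u v w
      - (1 / (n - 2)) • (ricci G y v w • u - ricci G y u w • v
          + G y v w • ricciSharp G y u - G y u w • ricciSharp G y v)
      + (scalar G y / ((n - 1) * (n - 2))) • (G y v w • u - G y u w • v)

end LocalMetric

/-! ### Pseudo-Riemannian metrics on manifolds without boundary -/

section Manifold

variable {E : Type*} [NormedAddCommGroup E] [NormedSpace ℝ E]
  {H : Type*} [TopologicalSpace H] (I : ModelWithCorners ℝ E H)
  {M : Type*} [TopologicalSpace M] [ChartedSpace H M]

/-- A field of bilinear forms on the tangent spaces of `M`. -/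
abbrev BilinField (M : Type*) [TopologicalSpace M] [ChartedSpace H M] : Type _ :=
  ∀ x : M, TangentSpace I x →L[ℝ] TangentSpace I x →L[ℝ] ℝ

/-- A (smooth) pseudo-Riemannian metric: a smooth field of symmetric nondegenerate bilinear
forms. -/
structure IsPseudoRiemannianMetric [IsManifold I ∞ M] (g : BilinField I M) : Prop where
  symm : ∀ (x : M) (v w : TangentSpace I x), g x v w = g x w v
  nondegenerate : ∀ (x : M) (v : TangentSpace I x), (∀ w : TangentSpace I x, g x v w = 0) → v = 0
  contMDiff : ContMDiff I (I.prod 𝓘(ℝ, E →L[ℝ] E →L[ℝ] ℝ)) ∞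
    (fun x : M => Bundle.TotalSpace.mk' (E →L[ℝ] E →L[ℝ] ℝ)
      (E := fun x : M => TangentSpace I x →L[ℝ] TangentSpace I x →L[ℝ] ℝ) x (g x))

/-- The expression of `g` in the chart `e`: its pullback under the inverse of the chart. -/
def inChart (g : BilinField I M) (e : OpenPartialHomeomorph M H) : E → E →L[ℝ] E →L[ℝ] ℝ :=
  fun y => LocalMetric.pullback (E := E) (F := E) (g ((e.extend I).symm y))
    (mfderiv 𝓘(ℝ, E) I (e.extend I).symm y)

variable [FiniteDimensional ℝ E]

/-- `(M, g)` is of class `𝓘 ⊕ 𝓑`: the tensor `H = Ric - R / (2 (n - 1)) g` is a Codazzi tensor,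
that is, `(∇_u H)(v, w) = (∇_v H)(u, w)` (in every chart of the smooth structure). -/
def IsClassIB (g : BilinField I M) : Prop :=
  ∀ e ∈ IsManifold.maximalAtlas I ∞ M, ∀ y ∈ (e.extend I).target, ∀ u v w : E,
    LocalMetric.covDeriv (inChart I g e) (LocalMetric.hTensor (inChart I g e)) y u v w
      = LocalMetric.covDeriv (inChart I g e) (LocalMetric.hTensor (inChart I g e)) y v u w

/-- `(M, g)` has constant scalar curvature. -/
def HasConstantScalarCurvature (g : BilinField I M) : Prop :=
  ∃ c : ℝ, ∀ e ∈ IsManifold.maximalAtlas I ∞ M, ∀ y ∈ (e.extend I).target,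
    LocalMetric.scalar (inChart I g e) y = c

/-- `(∇_ε φ) C_{αβγ}^ε = 0` on `M`, where `C` is the Weyl tensor of `g`: the differential of `φ`
vanishes on all vectors `C(u, v) w` (in every chart of the smooth structure). -/
def GradientAnnihilatesWeyl (g : BilinField I M) (φ : M → ℝ) : Prop :=
  ∀ e ∈ IsManifold.maximalAtlas I ∞ M, ∀ y ∈ (e.extend I).target, ∀ u v w : E,
    fderiv ℝ (fun z => φ ((e.extend I).symm z)) y
      (LocalMetric.weyl (inChart I g e) y u v w) = 0

/-- The conformally changed metric `f⁻² g`. -/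
def conformalChange (g : BilinField I M) (f : M → ℝ) : BilinField I M :=
  fun x => ((f x) ^ 2)⁻¹ • g x

end Manifold

/-- The doubly warped product metric `(f₂ ∘ π₂)² π₁^* g₁ + (f₁ ∘ π₁)² π₂^* g₂` on `M₁ × M₂`. -/
def doublyWarpedMetric
    {E₁ : Type*} [NormedAddCommGroup E₁] [NormedSpace ℝ E₁]
    {H₁ : Type*} [TopologicalSpace H₁] (I₁ : ModelWithCorners ℝ E₁ H₁)
    {M₁ : Type*} [TopologicalSpace M₁] [ChartedSpace H₁ M₁]
    {E₂ : Type*} [NormedAddCommGroup E₂] [NormedSpace ℝ E₂]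
    {H₂ : Type*} [TopologicalSpace H₂] (I₂ : ModelWithCorners ℝ E₂ H₂)
    {M₂ : Type*} [TopologicalSpace M₂] [ChartedSpace H₂ M₂]
    (g₁ : BilinField I₁ M₁) (g₂ : BilinField I₂ M₂) (f₁ : M₁ → ℝ) (f₂ : M₂ → ℝ) :
    BilinField (I₁.prod I₂) (M₁ × M₂) :=
  fun p =>
    (f₂ p.2) ^ 2 • LocalMetric.pullback (E := E₁ × E₂) (F := E₁) (g₁ p.1)
      (mfderiv (I₁.prod I₂) I₁ (Prod.fst : M₁ × M₂ → M₁) p)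
    + (f₁ p.1) ^ 2 • LocalMetric.pullback (E := E₁ × E₂) (F := E₂) (g₂ p.2)
      (mfderiv (I₁.prod I₂) I₂ (Prod.snd : M₁ × M₂ → M₂) p)

end

open scoped Manifold ContDiff Bundle

set_option maxSynthPendingDepth 3

noncomputable section

namespace LocalMetric

variable {E : Type*} [NormedAddCommGroup E] [NormedSpace ℝ E]

/-! The doubly warped metric `g` is conformal to a product: `(f₁f₂)⁻² g = f₁⁻² g₁ + f₂⁻² g₂`. The
obstruction to class `𝓘 ⊕ 𝓑` is `D(u, v, w) = (∇_u H)(v, w) - (∇_v H)(u, w)` (`codazziDefect`), a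
multiple of the Cotton tensor. In dimension `n > 2` it satisfies `D(e^{2σ}G) = D(G) + (n - 2)
dσ(C(u, v) w)`, with `C` the Weyl tensor of `G` (`codazziDefect_expScale`).

Apply this to `g` with `σ = -log (f₁f₂)`. Then `dσ` is a multiple of `d(f₁f₂)`, which annihilates
the Weyl tensor, and `D(g) = 0`; hence `D` vanishes for the product metric. If the factor `f₁⁻² g₁`
has constant scalar curvature, `D` of the product on vectors tangent to that factor is `D` of the
factor (`codazziDefect_product`): in both cases the scalar curvature part of `H` contributes
nothing. So `D(f₁⁻² g₁) = 0`.

Apply the conformal formula once more, to `g₁` with `σ = -log f₁`. It gives `D(g₁) = (n₁ - 2) f₁⁻¹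
df₁(C¹(u, v) w)` when `n₁ > 2`, and the two conditions are equivalent point by point. If `n₁ ≤ 2`,
both hold automatically. All this takes place on open sets of vector spaces
(`codazziDefect_eq_zero_iff_of_doublyWarped`) and is carried to manifolds through product charts. -/

/-- `G` is a smooth pseudo-Riemannian metric on the open set `U` of the vector space `E`. -/
structure IsMetricOn (G : E → E →L[ℝ] E →L[ℝ] ℝ) (U : Set E) : Prop where
  isOpen : IsOpen U
  contDiffOn : ContDiffOn ℝ ∞ G U
  symm : ∀ y ∈ U, ∀ v w, G y v w = G y w v
  nondegenerate : ∀ y ∈ U, ∀ v, (∀ w, G y v w = 0) → v = 0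

/-! ### Derivatives of smooth tensor fields on an open set -/

section Calculus

variable {F F' : Type*} [NormedAddCommGroup F] [NormedSpace ℝ F]
  [NormedAddCommGroup F'] [NormedSpace ℝ F']

theorem fderiv_apply_const {T : E → F →L[ℝ] F'} {y : E} (hT : DifferentiableAt ℝ T y) (u : E)
    (v : F) : fderiv ℝ (fun z => T z v) y u = fderiv ℝ T y u v := by
  rw [fderiv_clm_apply hT (differentiableAt_const v)]
  simp

theorem fderiv_apply_const₂ {F'' : Type*} [NormedAddCommGroup F''] [NormedSpace ℝ F'']
    {T : E → F →L[ℝ] F'' →L[ℝ] F'} {y : E} (hT : DifferentiableAt ℝ T y)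
    (u : E) (v : F) (w : F'') : fderiv ℝ (fun z => T z v w) y u = fderiv ℝ T y u v w := by
  rw [fderiv_apply_const (T := fun z => T z v)
    (hT.clm_apply (differentiableAt_const v)), fderiv_apply_const hT]

theorem contDiffOn_fderiv {T : E → F} {U : Set E} (hU : IsOpen U) (hT : ContDiffOn ℝ ∞ T U) :
    ContDiffOn ℝ ∞ (fderiv ℝ T) U :=
  hT.fderiv_of_isOpen hU (by simp)

theorem differentiableAt_of_contDiffOn {T : E → F} {U : Set E} (hU : IsOpen U)
    (hT : ContDiffOn ℝ ∞ T U) {y : E} (hy : y ∈ U) : DifferentiableAt ℝ T y :=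
  (hT.contDiffAt (hU.mem_nhds hy)).differentiableAt (by simp)

theorem fderiv_fderiv_symm {T : E → F} {U : Set E} (hU : IsOpen U)
    (hT : ContDiffOn ℝ ∞ T U) {y : E} (hy : y ∈ U) (u v : E) :
    fderiv ℝ (fderiv ℝ T) y u v = fderiv ℝ (fderiv ℝ T) y v u :=
  ((hT.contDiffAt (hU.mem_nhds hy)).isSymmSndFDerivAt
    (by
      rw [minSmoothness_of_isRCLikeNormedField]
      exact WithTop.coe_le_coe.2 (le_top : (2 : ℕ∞) ≤ ⊤))) u v

end Calculus

/-! ### Levi-Civita connection and symmetries of the curvature -/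

theorem riemann_antisymm (G : E → E →L[ℝ] E →L[ℝ] ℝ) (y u v w : E) :
    riemann G y u v w = -riemann G y v u w := by
  rw [riemann_apply, riemann_apply]
  abel

namespace IsMetricOn

variable {G : E → E →L[ℝ] E →L[ℝ] ℝ} {U : Set E} {y : E}

theorem ext (hG : IsMetricOn G U) (hy : y ∈ U) {v v' : E} (h : ∀ w, G y v w = G y v' w) :
    v = v' := by
  rw [← sub_eq_zero]
  exact hG.nondegenerate y hy _ fun w => by simp [h w]

theorem differentiableAt (hG : IsMetricOn G U) (hy : y ∈ U) : DifferentiableAt ℝ G y :=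
  differentiableAt_of_contDiffOn hG.isOpen hG.contDiffOn hy

theorem fderiv_symm (hG : IsMetricOn G U) (hy : y ∈ U) (u v w : E) :
    fderiv ℝ G y u v w = fderiv ℝ G y u w v := by
  rw [← fderiv_apply_const₂ (hG.differentiableAt hy), ← fderiv_apply_const₂ (hG.differentiableAt hy)]
  have : (fun z => G z v w) =ᶠ[nhds y] fun z => G z w v := by
    filter_upwards [hG.isOpen.mem_nhds hy] with z hz using hG.symm z hz v w
  rw [this.fderiv_eq]

variable [FiniteDimensional ℝ E]

/-- Nondegeneracy is injectivity into the dual, which has the same dimension. Without it `(G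
y).inverse` would be the default value `0`; with it, raising an index is genuine. -/
theorem isInvertible (hG : IsMetricOn G U) (hy : y ∈ U) : (G y).IsInvertible := by
  have hinj : Function.Injective (G y : E →ₗ[ℝ] E →L[ℝ] ℝ) := by
    rw [← LinearMap.ker_eq_bot, LinearMap.ker_eq_bot']
    intro v hv
    exact hG.nondegenerate y hy v fun w => by
      have := congrArg (fun a : E →L[ℝ] ℝ => a w) hv
      simpa using this
  have hdim : Module.finrank ℝ E = Module.finrank ℝ (E →L[ℝ] ℝ) := by
    rw [← LinearEquiv.finrank_eq (LinearMap.toContinuousLinearMap (𝕜 := ℝ) (E := E) (F' := ℝ))]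
    exact Subspace.dual_finrank_eq.symm
  refine ⟨(LinearEquiv.ofInjectiveOfFinrankEq _ hinj hdim).toContinuousLinearEquiv, ?_⟩
  ext v w
  rfl

theorem apply_inverse (hG : IsMetricOn G U) (hy : y ∈ U) (a : E →L[ℝ] ℝ) :
    G y ((G y).inverse a) = a :=
  (hG.isInvertible hy).self_apply_inverse a

theorem inverse_eq (hG : IsMetricOn G U) (hy : y ∈ U) {a : E →L[ℝ] ℝ} {v : E}
    (h : ∀ w, G y v w = a w) : (G y).inverse a = v :=
  hG.ext hy fun w => by rw [hG.apply_inverse hy, h]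

theorem contDiffOn_inverse (hG : IsMetricOn G U) :
    ContDiffOn ℝ ∞ (fun z => (G z).inverse) U := by
  have := FiniteDimensional.complete ℝ E
  intro y hy
  exact ((hG.isInvertible hy).contDiffAt_map_inverse).comp_contDiffWithinAt y (hG.contDiffOn y hy)

theorem contDiffOn_koszul (hG : IsMetricOn G U) : ContDiffOn ℝ ∞ (koszul G) U := by
  have hD := contDiffOn_fderiv hG.isOpen hG.contDiffOn
  simp only [contDiffOn_clm_apply, koszul_apply] at hD ⊢
  exact fun u v w => contDiffOn_const.mul (((hD u v w).add (hD v u w)).sub (hD w u v))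

theorem contDiffOn_christoffel (hG : IsMetricOn G U) : ContDiffOn ℝ ∞ (christoffel G) U := by
  have hK := hG.contDiffOn_koszul
  rw [contDiffOn_clm_apply] at hK ⊢
  intro u
  have hK := hK u
  rw [contDiffOn_clm_apply] at hK ⊢
  intro v
  simp only [christoffel_apply]
  exact hG.contDiffOn_inverse.clm_apply (hK v)

theorem differentiableAt_christoffel (hG : IsMetricOn G U) (hy : y ∈ U) :
    DifferentiableAt ℝ (christoffel G) y :=
  differentiableAt_of_contDiffOn hG.isOpen hG.contDiffOn_christoffel hy

theorem apply_christoffel (hG : IsMetricOn G U) (hy : y ∈ U) (u v w : E) :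
    G y (christoffel G y u v) w
      = (1 / 2 : ℝ) * (fderiv ℝ G y u v w + fderiv ℝ G y v u w - fderiv ℝ G y w u v) := by
  rw [christoffel_apply, hG.apply_inverse hy, koszul_apply]

theorem christoffel_symm (hG : IsMetricOn G U) (hy : y ∈ U) (u v : E) :
    christoffel G y u v = christoffel G y v u := by
  refine hG.ext hy fun w => ?_
  rw [hG.apply_christoffel hy, hG.apply_christoffel hy, hG.fderiv_symm hy w u v]
  ring

theorem fderiv_eq (hG : IsMetricOn G U) (hy : y ∈ U) (u v w : E) :
    fderiv ℝ G y u v w = G y (christoffel G y u v) w + G y v (christoffel G y u w) := by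
  rw [hG.symm y hy v, hG.apply_christoffel hy, hG.apply_christoffel hy, hG.fderiv_symm hy u v w,
    hG.fderiv_symm hy v u w, hG.fderiv_symm hy w u v]
  ring

theorem covDeriv_self (hG : IsMetricOn G U) (hy : y ∈ U) (u v w : E) :
    covDeriv G G y u v w = 0 := by
  rw [covDeriv, hG.fderiv_eq hy]
  ring

theorem fderiv_christoffel_symm (hG : IsMetricOn G U) (hy : y ∈ U) (u v w : E) :
    fderiv ℝ (christoffel G) y u v w = fderiv ℝ (christoffel G) y u w v := by
  have hd := hG.differentiableAt_christoffel hy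
  rw [← fderiv_apply_const₂ hd, ← fderiv_apply_const₂ hd]
  have : (fun z => christoffel G z v w) =ᶠ[nhds y] fun z => christoffel G z w v := by
    filter_upwards [hG.isOpen.mem_nhds hy] with z hz using hG.christoffel_symm hz v w
  rw [this.fderiv_eq]

theorem bianchi (hG : IsMetricOn G U) (hy : y ∈ U) (u v w : E) :
    riemann G y u v w + riemann G y v w u + riemann G y w u v = 0 := by
  rw [riemann_apply, riemann_apply, riemann_apply, hG.fderiv_christoffel_symm hy u v w,
    hG.fderiv_christoffel_symm hy v u w, hG.fderiv_christoffel_symm hy w u v,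
    hG.christoffel_symm hy v w, hG.christoffel_symm hy u w, hG.christoffel_symm hy v u]
  abel

/-- The derivative of the compatibility identity `fderiv_eq`; antisymmetrizing it in `z`, `u`
produces the curvature. -/
theorem fderiv_fderiv_eq (hG : IsMetricOn G U) (hy : y ∈ U) (z u v w : E) :
    fderiv ℝ (fderiv ℝ G) y z u v w
      = (fderiv ℝ G y z (christoffel G y u v) w + G y (fderiv ℝ (christoffel G) y z u v) w)
        + (fderiv ℝ G y z v (christoffel G y u w) + G y v (fderiv ℝ (christoffel G) y z u w)) := by
  have hD := differentiableAt_of_contDiffOn hG.isOpen (contDiffOn_fderiv hG.isOpen hG.contDiffOn) hy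
  have hGd := hG.differentiableAt hy
  have hΓ := hG.differentiableAt_christoffel hy
  rw [← fderiv_apply_const hD, ← fderiv_apply_const₂ (T := fun x => fderiv ℝ G x u)
    (hD.clm_apply (differentiableAt_const u))]
  have : (fun x => fderiv ℝ G x u v w) =ᶠ[nhds y]
      fun x => G x (christoffel G x u v) w + G x v (christoffel G x u w) := by
    filter_upwards [hG.isOpen.mem_nhds hy] with x hx using hG.fderiv_eq hx u v w
  rw [this.fderiv_eq]
  have hΓ' : ∀ a b, DifferentiableAt ℝ (fun x => christoffel G x a b) y := fun a b =>
    (hΓ.clm_apply (differentiableAt_const a)).clm_apply (differentiableAt_const b)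
  have h1 : DifferentiableAt ℝ (fun x => G x (christoffel G x u v)) y := hGd.clm_apply (hΓ' u v)
  have h2 : DifferentiableAt ℝ (fun x => G x v) y := hGd.clm_apply (differentiableAt_const v)
  rw [fderiv_fun_add (h1.clm_apply (differentiableAt_const w)) (h2.clm_apply (hΓ' u w)),
    fderiv_clm_apply h1 (differentiableAt_const w), fderiv_clm_apply h2 (hΓ' u w),
    fderiv_clm_apply hGd (hΓ' u v), fderiv_clm_apply hGd (differentiableAt_const v)]
  simp [fderiv_apply_const₂ hΓ]
  ring

/-- The second derivative of `G` is symmetric, and the antisymmetrization of `fderiv_fderiv_eq` is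
the sum of the two curvature terms. -/
theorem apply_riemann_skew (hG : IsMetricOn G U) (hy : y ∈ U) (z u v w : E) :
    G y (riemann G y z u v) w = -G y v (riemann G y z u w) := by
  have h := fderiv_fderiv_symm hG.isOpen hG.contDiffOn hy z u
  have h := congrArg (fun A : E →L[ℝ] E →L[ℝ] ℝ => A v w) h
  simp only [hG.fderiv_fderiv_eq hy, hG.fderiv_eq hy] at h
  simp only [riemann_apply, map_add, map_sub, _root_.add_apply,
    _root_.sub_apply]
  linarith

/-- The isomorphism of `E` with its dual given by the metric conjugates `A` to minus its transpose,
so `tr A = -tr A`. No orthonormal basis is needed, whatever the signature. -/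
theorem trace_eq_zero_of_skew (hG : IsMetricOn G U) (hy : y ∈ U) (A : E →ₗ[ℝ] E)
    (hA : ∀ v w, G y (A v) w = -G y v (A w)) : LinearMap.trace ℝ E A = 0 := by
  obtain ⟨e, he⟩ := hG.isInvertible hy
  let e' : E ≃ₗ[ℝ] Module.Dual ℝ E :=
    e.toLinearEquiv.trans (LinearMap.toContinuousLinearMap (𝕜 := ℝ) (E := E) (F' := ℝ)).symm
  have he' : ∀ v w, e' v w = G y v w := fun v w => by rw [← he]; rfl
  have h1 := LinearMap.trace_conj' A e'
  have h2 : e'.conj A = -Module.Dual.transpose (R := ℝ) A := by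
    ext a w
    obtain ⟨v, rfl⟩ := e'.surjective a
    simp [LinearEquiv.conj_apply, Module.Dual.transpose_apply, he', hA]
  rw [h2, map_neg, LinearMap.trace_transpose'] at h1
  linarith

/-- By the first Bianchi identity the two endomorphisms being traced differ by `-R(v, w)`, which is
skew and so has trace zero. -/
theorem ricci_symm (hG : IsMetricOn G U) (hy : y ∈ U) (v w : E) :
    ricci G y v w = ricci G y w v := by
  rw [ricci_apply, ricci_apply, ← sub_eq_zero, ← map_sub]
  refine hG.trace_eq_zero_of_skew hy _ fun a b => ?_
  have h : ∀ x : E, riemann G y x v w - riemann G y x w v = - riemann G y v w x := fun x => by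
    have := hG.bianchi hy x v w
    rw [riemann_antisymm G y x w v]
    rw [← sub_eq_zero, ← this]
    abel
  have := hG.apply_riemann_skew hy v w a b
  simp only [LinearMap.sub_apply, ContinuousLinearMap.coe_coe, ContinuousLinearMap.flip_apply, h,
    map_neg, _root_.neg_apply]
  linarith

theorem apply_ricciSharp (hG : IsMetricOn G U) (hy : y ∈ U) (v w : E) :
    G y (ricciSharp G y v) w = ricci G y v w := by
  rw [ricciSharp, ContinuousLinearMap.comp_apply, hG.apply_inverse hy]

theorem hTensor_symm (hG : IsMetricOn G U) (hy : y ∈ U) (v w : E) :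
    hTensor G y v w = hTensor G y w v := by
  simp [hTensor, hG.ricci_symm hy v w, hG.symm y hy v w]

theorem contDiffOn_riemann (hG : IsMetricOn G U) : ContDiffOn ℝ ∞ (riemann G) U := by
  have hΓ := hG.contDiffOn_christoffel
  have hD := contDiffOn_fderiv hG.isOpen hΓ
  simp only [contDiffOn_clm_apply, riemann_apply] at hD ⊢
  intro u v w
  have h : ∀ a b, ContDiffOn ℝ ∞ (fun z => christoffel G z a b) U := fun a b =>
    (hΓ.clm_apply contDiffOn_const).clm_apply contDiffOn_const
  exact (((hD u v w).sub (hD v u w)).add ((hΓ.clm_apply contDiffOn_const).clm_apply (h v w))).sub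
    ((hΓ.clm_apply contDiffOn_const).clm_apply (h u w))

theorem contDiffOn_ricci (hG : IsMetricOn G U) : ContDiffOn ℝ ∞ (ricci G) U := by
  have hR := hG.contDiffOn_riemann
  simp only [contDiffOn_clm_apply]
  intro v w
  have h : ContDiffOn ℝ ∞ (fun z => ((riemann G z).flip v).flip w) U := by
    simp only [contDiffOn_clm_apply, ContinuousLinearMap.flip_apply] at hR ⊢
    exact fun u => hR u v w
  exact (traceCLM (E := E)).contDiff.comp_contDiffOn h

theorem contDiffOn_scalar (hG : IsMetricOn G U) : ContDiffOn ℝ ∞ (scalar G) U :=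
  (traceCLM (E := E)).contDiff.comp_contDiffOn (hG.contDiffOn_inverse.clm_comp hG.contDiffOn_ricci)

theorem contDiffOn_hTensor (hG : IsMetricOn G U) : ContDiffOn ℝ ∞ (hTensor G) U :=
  hG.contDiffOn_ricci.sub ((hG.contDiffOn_scalar.div_const _).smul hG.contDiffOn)

end IsMetricOn

/-! ### Conformal change of the connection and of the Riemann tensor -/

variable {E : Type*} [NormedAddCommGroup E] [NormedSpace ℝ E]

/-- The conformally related metric `e^{2σ} G`. -/
def expScale (σ : E → ℝ) (G : E → E →L[ℝ] E →L[ℝ] ℝ) : E → E →L[ℝ] E →L[ℝ] ℝ :=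
  fun z => Real.exp (2 * σ z) • G z

/-- The gradient of `σ` with respect to `G`. -/
def gradient (G : E → E →L[ℝ] E →L[ℝ] ℝ) (σ : E → ℝ) (y : E) : E :=
  (G y).inverse (fderiv ℝ σ y)

/-- The covariant Hessian of `σ` with respect to `G`. -/
def hessian (G : E → E →L[ℝ] E →L[ℝ] ℝ) (σ : E → ℝ) (y : E) : E →L[ℝ] E →L[ℝ] ℝ :=
  fderiv ℝ (fderiv ℝ σ) y
    - (ContinuousLinearMap.compL ℝ E E ℝ (fderiv ℝ σ y)).comp (christoffel G y)

theorem hessian_apply (G : E → E →L[ℝ] E →L[ℝ] ℝ) (σ : E → ℝ) (y u v : E) :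
    hessian G σ y u v
      = fderiv ℝ (fderiv ℝ σ) y u v - fderiv ℝ σ y (christoffel G y u v) := by
  simp [hessian]

/-- The change `∇dσ - dσ ⊗ dσ + ½ |dσ|² G` of the Schouten tensor, up to sign, when passing from
`G` to `e^{2σ} G`. -/
def schoutenShift (G : E → E →L[ℝ] E →L[ℝ] ℝ) (σ : E → ℝ) (y : E) : E →L[ℝ] E →L[ℝ] ℝ :=
  hessian G σ y - (fderiv ℝ σ y).smulRight (fderiv ℝ σ y)
    + (1 / 2 * fderiv ℝ σ y (gradient G σ y)) • G y

theorem schoutenShift_apply (G : E → E →L[ℝ] E →L[ℝ] ℝ) (σ : E → ℝ) (y u v : E) :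
    schoutenShift G σ y u v
      = hessian G σ y u v - fderiv ℝ σ y u * fderiv ℝ σ y v
        + 1 / 2 * fderiv ℝ σ y (gradient G σ y) * G y u v := by
  simp [schoutenShift]

/-- `schoutenShift` with one index raised. -/
def schoutenShiftSharp (G : E → E →L[ℝ] E →L[ℝ] ℝ) (σ : E → ℝ) (y : E) : E →L[ℝ] E :=
  (G y).inverse.comp (schoutenShift G σ y)

namespace IsMetricOn

variable {G : E → E →L[ℝ] E →L[ℝ] ℝ} {σ : E → ℝ} {U : Set E} {y : E}

theorem expScale (hG : IsMetricOn G U) (hσ : ContDiffOn ℝ ∞ σ U) :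
    IsMetricOn (expScale σ G) U where
  isOpen := hG.isOpen
  contDiffOn := (Real.contDiff_exp.comp_contDiffOn (contDiffOn_const.mul hσ)).smul hG.contDiffOn
  symm y hy v w := by simp [LocalMetric.expScale, hG.symm y hy v w]
  nondegenerate y hy v hv := hG.nondegenerate y hy v fun w => by
    simpa [LocalMetric.expScale] using hv w

theorem fderiv_expScale (hG : IsMetricOn G U) (hσ : ContDiffOn ℝ ∞ σ U) (hy : y ∈ U)
    (u v w : E) :
    fderiv ℝ (LocalMetric.expScale σ G) y u v w
      = Real.exp (2 * σ y) * (2 * fderiv ℝ σ y u * G y v w + fderiv ℝ G y u v w) := by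
  have hs := differentiableAt_of_contDiffOn hG.isOpen hσ hy
  have h2 : HasFDerivAt (fun z => Real.exp (2 * σ z))
      (Real.exp (2 * σ y) • ((2 : ℝ) • fderiv ℝ σ y)) y := (hs.hasFDerivAt.const_mul 2).exp
  have h : HasFDerivAt (LocalMetric.expScale σ G) _ y := h2.smul (hG.differentiableAt hy).hasFDerivAt
  rw [h.fderiv]
  simp
  ring

theorem fderiv_fderiv_apply (hG : IsMetricOn G U) (hσ : ContDiffOn ℝ ∞ σ U) (hy : y ∈ U)
    (u v : E) : fderiv ℝ (fun z => fderiv ℝ σ z v) y u = fderiv ℝ (fderiv ℝ σ) y u v :=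
  fderiv_apply_const
    (differentiableAt_of_contDiffOn hG.isOpen (contDiffOn_fderiv hG.isOpen hσ) hy) u v

variable [FiniteDimensional ℝ E]

theorem apply_gradient (hG : IsMetricOn G U) (hy : y ∈ U) (w : E) :
    G y (gradient G σ y) w = fderiv ℝ σ y w := by
  rw [gradient, hG.apply_inverse hy]

theorem contDiffOn_gradient (hG : IsMetricOn G U) (hσ : ContDiffOn ℝ ∞ σ U) :
    ContDiffOn ℝ ∞ (gradient G σ) U :=
  hG.contDiffOn_inverse.clm_apply (contDiffOn_fderiv hG.isOpen hσ)

theorem differentiableAt_gradient (hG : IsMetricOn G U) (hσ : ContDiffOn ℝ ∞ σ U) (hy : y ∈ U) :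
    DifferentiableAt ℝ (gradient G σ) y :=
  differentiableAt_of_contDiffOn hG.isOpen (hG.contDiffOn_gradient hσ) hy

theorem hessian_symm (hG : IsMetricOn G U) (hσ : ContDiffOn ℝ ∞ σ U) (hy : y ∈ U) (u v : E) :
    hessian G σ y u v = hessian G σ y v u := by
  rw [hessian_apply, hessian_apply, fderiv_fderiv_symm hG.isOpen hσ hy, hG.christoffel_symm hy]

/-- Lowering an index commutes with `∇`: differentiate `G(grad σ, w) = dσ(w)` and use metric
compatibility. -/
theorem apply_covDeriv_gradient (hG : IsMetricOn G U) (hσ : ContDiffOn ℝ ∞ σ U) (hy : y ∈ U)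
    (u w : E) :
    G y (fderiv ℝ (gradient G σ) y u + christoffel G y u (gradient G σ y)) w
      = hessian G σ y u w := by
  have hGd := hG.differentiableAt hy
  have hA := hG.differentiableAt_gradient hσ hy
  have : (fun z => G z (gradient G σ z) w) =ᶠ[nhds y] fun z => fderiv ℝ σ z w := by
    filter_upwards [hG.isOpen.mem_nhds hy] with z hz using hG.apply_gradient hz w
  have h := congrArg (fun L : E →L[ℝ] ℝ => L u) this.fderiv_eq
  have h' := hG.fderiv_fderiv_apply hσ hy u w
  rw [h', fderiv_clm_apply (hGd.clm_apply hA) (differentiableAt_const w),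
    fderiv_clm_apply hGd hA] at h
  simp [hG.fderiv_eq hy, hG.apply_gradient hy] at h
  rw [hessian_apply, map_add, _root_.add_apply]
  linarith

theorem christoffel_expScale (hG : IsMetricOn G U) (hσ : ContDiffOn ℝ ∞ σ U) (hy : y ∈ U)
    (u v : E) :
    christoffel (LocalMetric.expScale σ G) y u v
      = christoffel G y u v + fderiv ℝ σ y u • v + fderiv ℝ σ y v • u
        - G y u v • gradient G σ y := by
  refine (hG.expScale hσ).ext hy fun w => ?_
  rw [(hG.expScale hσ).apply_christoffel hy]
  simp only [hG.fderiv_expScale hσ hy]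
  simp only [LocalMetric.expScale, map_add, map_sub, map_smul, _root_.add_apply, _root_.sub_apply,
    _root_.smul_apply, smul_eq_mul, hG.apply_christoffel hy, hG.apply_gradient hy]
  ring

theorem fderiv_christoffel_expScale (hG : IsMetricOn G U) (hσ : ContDiffOn ℝ ∞ σ U) (hy : y ∈ U)
    (u v w : E) :
    fderiv ℝ (christoffel (LocalMetric.expScale σ G)) y u v w
      = fderiv ℝ (christoffel G) y u v w + fderiv ℝ (fderiv ℝ σ) y u v • w
        + fderiv ℝ (fderiv ℝ σ) y u w • v
        - (fderiv ℝ G y u v w • gradient G σ y + G y v w • fderiv ℝ (gradient G σ) y u) := by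
  have hΓ := hG.differentiableAt_christoffel hy
  have hGd := hG.differentiableAt hy
  have ha := differentiableAt_of_contDiffOn hG.isOpen (contDiffOn_fderiv hG.isOpen hσ) hy
  have hA := hG.differentiableAt_gradient hσ hy
  rw [← fderiv_apply_const₂ ((hG.expScale hσ).differentiableAt_christoffel hy)]
  have : (fun z => christoffel (LocalMetric.expScale σ G) z v w) =ᶠ[nhds y]
      fun z => christoffel G z v w + fderiv ℝ σ z v • w + fderiv ℝ σ z w • v
        - G z v w • gradient G σ z := by
    filter_upwards [hG.isOpen.mem_nhds hy] with z hz using hG.christoffel_expScale hσ hz v w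
  have hc : ∀ x : E, DifferentiableAt ℝ (fun _ : E => x) y := fun x => differentiableAt_const x
  have d1 := ((hΓ.clm_apply (hc v)).clm_apply (hc w)).hasFDerivAt
  have d2 := ((ha.clm_apply (hc v)).hasFDerivAt).smul_const w
  have d3 := ((ha.clm_apply (hc w)).hasFDerivAt).smul_const v
  have d4 := ((hGd.clm_apply (hc v)).clm_apply (hc w)).hasFDerivAt.fun_smul hA.hasFDerivAt
  rw [this.fderiv_eq, (((d1.fun_add d2).fun_add d3).fun_sub d4).fderiv]
  simp only [_root_.add_apply, _root_.sub_apply, _root_.smul_apply,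
    ContinuousLinearMap.smulRight_apply, fderiv_apply_const₂ hΓ, fderiv_apply_const₂ hGd,
    hG.fderiv_fderiv_apply hσ hy]
  abel

theorem schoutenShiftSharp_apply (hG : IsMetricOn G U) (hσ : ContDiffOn ℝ ∞ σ U) (hy : y ∈ U)
    (u : E) :
    schoutenShiftSharp G σ y u
      = fderiv ℝ (gradient G σ) y u + christoffel G y u (gradient G σ y)
        - fderiv ℝ σ y u • gradient G σ y
        + (1 / 2 * fderiv ℝ σ y (gradient G σ y)) • u := by
  refine hG.inverse_eq hy (a := schoutenShift G σ y u) fun w => ?_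
  rw [map_add, map_sub, _root_.add_apply, _root_.sub_apply, hG.apply_covDeriv_gradient hσ hy,
    schoutenShift_apply]
  simp [hG.apply_gradient hy]

theorem apply_schoutenShiftSharp (hG : IsMetricOn G U) (hy : y ∈ U) (u w : E) :
    G y (schoutenShiftSharp G σ y u) w = schoutenShift G σ y u w := by
  rw [schoutenShiftSharp, ContinuousLinearMap.comp_apply, hG.apply_inverse hy]

/-- `schoutenShift` is designed to collect the Hessian of `σ` and all terms quadratic in `dσ`, so
that the change is a Kulkarni–Nomizu product with `G`. -/
theorem riemann_expScale (hG : IsMetricOn G U) (hσ : ContDiffOn ℝ ∞ σ U) (hy : y ∈ U)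
    (u v w : E) :
    riemann (LocalMetric.expScale σ G) y u v w
      = riemann G y u v w + schoutenShift G σ y u w • v - schoutenShift G σ y v w • u
        - G y v w • schoutenShiftSharp G σ y u + G y u w • schoutenShiftSharp G σ y v := by
  rw [riemann_apply, riemann_apply]
  simp only [hG.fderiv_christoffel_expScale hσ hy, hG.christoffel_expScale hσ hy,
    hG.schoutenShiftSharp_apply hσ hy, schoutenShift_apply, hessian_apply, hG.fderiv_eq hy,
    map_add, map_sub, map_smul, smul_eq_mul]
  rw [fderiv_fderiv_symm hG.isOpen hσ hy v u, hG.christoffel_symm hy v u, hG.symm y hy v u,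
    hG.symm y hy v (christoffel G y u w), hG.symm y hy u (christoffel G y v w),
    hG.symm y hy v (gradient G σ y), hG.symm y hy u (gradient G σ y),
    hG.apply_gradient hy, hG.apply_gradient hy]
  module

end IsMetricOn
-- Conformal change of the Ricci tensor, of `H` and of its Codazzi defect
variable {E : Type*} [NormedAddCommGroup E] [NormedSpace ℝ E] [FiniteDimensional ℝ E]

/-- The failure of `hTensor G` to be a Codazzi tensor. Up to a constant factor this is the Cotton
tensor of `G`. -/
def codazziDefect (G : E → E →L[ℝ] E →L[ℝ] ℝ) (y u v w : E) : ℝ :=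
  covDeriv G (hTensor G) y u v w - covDeriv G (hTensor G) y v u w

namespace IsMetricOn

variable {G : E → E →L[ℝ] E →L[ℝ] ℝ} {σ : E → ℝ} {U : Set E} {y : E}

theorem ricci_expScale (hG : IsMetricOn G U) (hσ : ContDiffOn ℝ ∞ σ U) (hy : y ∈ U) :
    ricci (LocalMetric.expScale σ G) y
      = ricci G y - ((Module.finrank ℝ E : ℝ) - 2) • schoutenShift G σ y
        - LinearMap.trace ℝ E (schoutenShiftSharp G σ y : E →ₗ[ℝ] E) • G y := by
  ext v w
  -- The two rank-one terms have trace `S(v, w)` each and the identity has trace `n`, where `S` is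
  -- `schoutenShift`; hence the coefficient `-(n - 2)`.
  have h : ((((riemann (LocalMetric.expScale σ G) y).flip v).flip w : E →L[ℝ] E) : E →ₗ[ℝ] E)
      = ((((riemann G y).flip v).flip w : E →L[ℝ] E) : E →ₗ[ℝ] E)
        + ((schoutenShift G σ y).flip w : E →ₗ[ℝ] ℝ).smulRight v
        - schoutenShift G σ y v w • LinearMap.id
        - G y v w • (schoutenShiftSharp G σ y : E →ₗ[ℝ] E)
        + ((G y).flip w : E →ₗ[ℝ] ℝ).smulRight (schoutenShiftSharp G σ y v) := by
    ext u
    simp [hG.riemann_expScale hσ hy]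
  rw [ricci_apply, h]
  simp only [map_add, map_sub, map_smul, LinearMap.trace_smulRight, LinearMap.trace_id,
    _root_.sub_apply, _root_.smul_apply, smul_eq_mul, ContinuousLinearMap.coe_coe,
    ContinuousLinearMap.flip_apply, hG.apply_schoutenShiftSharp hy, ← ricci_apply]
  ring

theorem ricciSharp_expScale (hG : IsMetricOn G U) (hσ : ContDiffOn ℝ ∞ σ U) (hy : y ∈ U) :
    ricciSharp (LocalMetric.expScale σ G) y
      = (Real.exp (2 * σ y))⁻¹ • (ricciSharp G y
        - ((Module.finrank ℝ E : ℝ) - 2) • schoutenShiftSharp G σ y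
        - LinearMap.trace ℝ E (schoutenShiftSharp G σ y : E →ₗ[ℝ] E)
          • ContinuousLinearMap.id ℝ E) := by
  ext v
  refine (hG.expScale hσ).inverse_eq hy (a := ricci (LocalMetric.expScale σ G) y v) fun w => ?_
  rw [hG.ricci_expScale hσ hy]
  simp [LocalMetric.expScale, hG.apply_ricciSharp hy, hG.apply_schoutenShiftSharp hy]

theorem scalar_expScale (hG : IsMetricOn G U) (hσ : ContDiffOn ℝ ∞ σ U) (hy : y ∈ U) :
    scalar (LocalMetric.expScale σ G) y
      = (Real.exp (2 * σ y))⁻¹ * (scalar G y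
        - 2 * ((Module.finrank ℝ E : ℝ) - 1)
          * LinearMap.trace ℝ E (schoutenShiftSharp G σ y : E →ₗ[ℝ] E)) := by
  rw [scalar, hG.ricciSharp_expScale hσ hy, scalar]
  simp
  ring

/-- The factor `1 / (2 (n - 1))` is exactly what cancels the trace of the shift. For `n = 1` the
division by zero returns `0`, the cancellation fails and the case must be excluded. -/
theorem hTensor_expScale (hG : IsMetricOn G U) (hσ : ContDiffOn ℝ ∞ σ U) (hy : y ∈ U)
    (hn : Module.finrank ℝ E ≠ 1) :
    hTensor (LocalMetric.expScale σ G) y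
      = hTensor G y - ((Module.finrank ℝ E : ℝ) - 2) • schoutenShift G σ y := by
  have hn' : (Module.finrank ℝ E : ℝ) - 1 ≠ 0 := sub_ne_zero.2 (mod_cast hn)
  ext v w
  simp only [hTensor, hG.ricci_expScale hσ hy, hG.scalar_expScale hσ hy]
  simp only [LocalMetric.expScale, _root_.sub_apply, _root_.smul_apply, smul_eq_mul]
  field_simp
  ring

/-- The `Γ(u, v)` terms cancel because the connection is torsion-free, and the `dσ(w)` terms because
`T` is symmetric. -/
theorem covDeriv_expScale_antisymm (hG : IsMetricOn G U) (hσ : ContDiffOn ℝ ∞ σ U) (hy : y ∈ U)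
    (T : E → E →L[ℝ] E →L[ℝ] ℝ) (hT : ∀ v w, T y v w = T y w v) (u v w : E) :
    covDeriv (LocalMetric.expScale σ G) T y u v w - covDeriv (LocalMetric.expScale σ G) T y v u w
      = covDeriv G T y u v w - covDeriv G T y v u w
        + fderiv ℝ σ y v * T y u w - fderiv ℝ σ y u * T y v w
        + G y u w * T y v (gradient G σ y) - G y v w * T y u (gradient G σ y) := by
  simp only [covDeriv, hG.christoffel_expScale hσ hy, map_add, map_sub, map_smul,
    _root_.add_apply, _root_.sub_apply, _root_.smul_apply, smul_eq_mul]
  rw [hG.christoffel_symm hy v u, hG.symm y hy v u, hT v u]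
  ring

theorem fderiv_normSq_gradient (hG : IsMetricOn G U) (hσ : ContDiffOn ℝ ∞ σ U) (hy : y ∈ U)
    (u : E) :
    fderiv ℝ (fun z => fderiv ℝ σ z (gradient G σ z)) y u
      = 2 * hessian G σ y u (gradient G σ y) := by
  have ha := differentiableAt_of_contDiffOn hG.isOpen (contDiffOn_fderiv hG.isOpen hσ) hy
  have hA := hG.differentiableAt_gradient hσ hy
  have h := hG.apply_covDeriv_gradient hσ hy u (gradient G σ y)
  rw [map_add, _root_.add_apply, hG.symm y hy, hG.apply_gradient hy, hG.symm y hy,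
    hG.apply_gradient hy, hessian_apply] at h
  rw [fderiv_clm_apply ha hA, hessian_apply]
  simp
  linarith

theorem contDiffOn_hessian (hG : IsMetricOn G U) (hσ : ContDiffOn ℝ ∞ σ U) :
    ContDiffOn ℝ ∞ (hessian G σ) U := by
  have ha := contDiffOn_fderiv hG.isOpen hσ
  have hda := contDiffOn_fderiv hG.isOpen ha
  have hΓ := hG.contDiffOn_christoffel
  simp only [contDiffOn_clm_apply, hessian_apply] at hda ⊢
  exact fun u v => (hda u v).sub
    (ha.clm_apply ((hΓ.clm_apply contDiffOn_const).clm_apply contDiffOn_const))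

theorem contDiffOn_schoutenShift (hG : IsMetricOn G U) (hσ : ContDiffOn ℝ ∞ σ U) :
    ContDiffOn ℝ ∞ (schoutenShift G σ) U := by
  have ha := contDiffOn_fderiv hG.isOpen hσ
  have hh := hG.contDiffOn_hessian hσ
  have hg := hG.contDiffOn
  have hN := ha.clm_apply (hG.contDiffOn_gradient hσ)
  simp only [contDiffOn_clm_apply, schoutenShift_apply] at hh hg ⊢
  exact fun u v => ((hh u v).sub ((ha.clm_apply contDiffOn_const).mul
    (ha.clm_apply contDiffOn_const))).add ((contDiffOn_const.mul hN).mul (hg u v))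

theorem fderiv_hessian (hG : IsMetricOn G U) (hσ : ContDiffOn ℝ ∞ σ U) (hy : y ∈ U) (u v w : E) :
    fderiv ℝ (hessian G σ) y u v w
      = fderiv ℝ (fderiv ℝ (fderiv ℝ σ)) y u v w
        - (fderiv ℝ (fderiv ℝ σ) y u (christoffel G y v w)
          + fderiv ℝ σ y (fderiv ℝ (christoffel G) y u v w)) := by
  have hda := contDiffOn_fderiv hG.isOpen (contDiffOn_fderiv hG.isOpen hσ)
  have ha := differentiableAt_of_contDiffOn hG.isOpen (contDiffOn_fderiv hG.isOpen hσ) hy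
  have hda := differentiableAt_of_contDiffOn hG.isOpen hda hy
  have hΓ := hG.differentiableAt_christoffel hy
  have hh := differentiableAt_of_contDiffOn hG.isOpen (hG.contDiffOn_hessian hσ) hy
  have hc : ∀ x : E, DifferentiableAt ℝ (fun _ : E => x) y := fun x => differentiableAt_const x
  rw [← fderiv_apply_const₂ hh]
  simp only [hessian_apply]
  have hΓ' := (hΓ.clm_apply (hc v)).clm_apply (hc w)
  rw [fderiv_fun_sub ((hda.clm_apply (hc v)).clm_apply (hc w)) (ha.clm_apply hΓ'),
    fderiv_clm_apply ha hΓ']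
  simp [fderiv_apply_const₂ hda, fderiv_apply_const₂ hΓ]
  ring

theorem fderiv_schoutenShift (hG : IsMetricOn G U) (hσ : ContDiffOn ℝ ∞ σ U) (hy : y ∈ U)
    (u v w : E) :
    fderiv ℝ (schoutenShift G σ) y u v w
      = fderiv ℝ (hessian G σ) y u v w
        - (fderiv ℝ σ y v * fderiv ℝ (fderiv ℝ σ) y u w
          + fderiv ℝ σ y w * fderiv ℝ (fderiv ℝ σ) y u v)
        + (1 / 2 * fderiv ℝ σ y (gradient G σ y) * fderiv ℝ G y u v w
          + G y v w * hessian G σ y u (gradient G σ y)) := by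
  have ha := differentiableAt_of_contDiffOn hG.isOpen (contDiffOn_fderiv hG.isOpen hσ) hy
  have hh := differentiableAt_of_contDiffOn hG.isOpen (hG.contDiffOn_hessian hσ) hy
  have hB := differentiableAt_of_contDiffOn hG.isOpen (hG.contDiffOn_schoutenShift hσ) hy
  have hN := ha.clm_apply (hG.differentiableAt_gradient hσ hy)
  have hGd := hG.differentiableAt hy
  have hc : ∀ x : E, DifferentiableAt ℝ (fun _ : E => x) y := fun x => differentiableAt_const x
  rw [← fderiv_apply_const₂ hB]
  simp only [schoutenShift_apply]
  have d1 := ((hh.clm_apply (hc v)).clm_apply (hc w)).hasFDerivAt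
  have d2 := (ha.clm_apply (hc v)).hasFDerivAt
  have d3 := (ha.clm_apply (hc w)).hasFDerivAt
  have d4 := (hN.hasFDerivAt).const_mul (1 / 2 : ℝ)
  have d5 := ((hGd.clm_apply (hc v)).clm_apply (hc w)).hasFDerivAt
  rw [((d1.fun_sub (d2.fun_mul d3)).fun_add (d4.fun_mul d5)).fderiv]
  simp only [_root_.add_apply, _root_.sub_apply, _root_.smul_apply, smul_eq_mul,
    fderiv_apply_const₂ hh, fderiv_apply_const₂ hGd, hG.fderiv_fderiv_apply hσ hy,
    hG.fderiv_normSq_gradient hσ hy]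
  ring

theorem schoutenShift_symm (hG : IsMetricOn G U) (hσ : ContDiffOn ℝ ∞ σ U) (hy : y ∈ U)
    (u v : E) : schoutenShift G σ y u v = schoutenShift G σ y v u := by
  rw [schoutenShift_apply, schoutenShift_apply, hG.hessian_symm hσ hy, hG.symm y hy]
  ring

/-- The Ricci identity for `dσ` gives the curvature term. The other terms cancel against the change
of connection, which is why the derivative is that of `e^{2σ} G` although the shift and the
curvature belong to `G`. -/
theorem covDeriv_schoutenShift_antisymm (hG : IsMetricOn G U) (hσ : ContDiffOn ℝ ∞ σ U)
    (hy : y ∈ U) (u v w : E) :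
    covDeriv (LocalMetric.expScale σ G) (schoutenShift G σ) y u v w
        - covDeriv (LocalMetric.expScale σ G) (schoutenShift G σ) y v u w
      = -fderiv ℝ σ y (riemann G y u v w) := by
  rw [hG.covDeriv_expScale_antisymm hσ hy _ (hG.schoutenShift_symm hσ hy)]
  -- The third derivatives of `σ` drop out by symmetry in `u`, `v`.
  have h3 := congrArg (fun A : E →L[ℝ] ℝ => A w) (fderiv_fderiv_symm hG.isOpen
    (contDiffOn_fderiv hG.isOpen hσ) hy u v)
  simp only [covDeriv, hG.fderiv_schoutenShift hσ hy, hG.fderiv_hessian hσ hy, h3,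
    schoutenShift_apply, hessian_apply, hG.fderiv_eq hy, riemann_apply, map_add, map_sub]
  rw [fderiv_fderiv_symm hG.isOpen hσ hy v u, hG.christoffel_symm hy v u,
    hG.symm y hy v (gradient G σ y), hG.symm y hy u (gradient G σ y),
    hG.apply_gradient hy, hG.apply_gradient hy]
  ring

/-- Since `H` becomes `H - (n - 2) S`, with `S` the shift, the new defect is the old one plus terms
pairing `dσ` with `H` plus `(n - 2) dσ(R(u, v) w)`. These additions combine into the Weyl tensor. -/
theorem codazziDefect_expScale (hG : IsMetricOn G U) (hσ : ContDiffOn ℝ ∞ σ U) (hy : y ∈ U)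
    (hn : 2 < Module.finrank ℝ E) (u v w : E) :
    codazziDefect (LocalMetric.expScale σ G) y u v w
      = codazziDefect G y u v w
        + ((Module.finrank ℝ E : ℝ) - 2) * fderiv ℝ σ y (weyl G y u v w) := by
  have hn2 : (2 : ℝ) < Module.finrank ℝ E := mod_cast hn
  have hn1' : (Module.finrank ℝ E : ℝ) - 1 ≠ 0 := by linarith
  have hn2' : (Module.finrank ℝ E : ℝ) - 2 ≠ 0 := by linarith
  have hH := differentiableAt_of_contDiffOn hG.isOpen hG.contDiffOn_hTensor hy
  have hB := differentiableAt_of_contDiffOn hG.isOpen (hG.contDiffOn_schoutenShift hσ) hy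
  have heq : hTensor (LocalMetric.expScale σ G) =ᶠ[nhds y]
      fun z => hTensor G z - ((Module.finrank ℝ E : ℝ) - 2) • schoutenShift G σ z := by
    filter_upwards [hG.isOpen.mem_nhds hy] with z hz
      using hG.hTensor_expScale hσ hz (by omega)
  have hcov : ∀ a b c, covDeriv (LocalMetric.expScale σ G)
      (hTensor (LocalMetric.expScale σ G)) y a b c
      = covDeriv (LocalMetric.expScale σ G) (hTensor G) y a b c
        - ((Module.finrank ℝ E : ℝ) - 2)
          * covDeriv (LocalMetric.expScale σ G) (schoutenShift G σ) y a b c := fun a b c => by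
    simp only [covDeriv]
    rw [heq.fderiv_eq, heq.self_of_nhds, fderiv_fun_sub hH (hB.fun_const_smul _),
      fderiv_fun_const_smul hB]
    simp only [_root_.sub_apply, _root_.smul_apply, smul_eq_mul]
    ring
  have h1 := hG.covDeriv_expScale_antisymm hσ hy _ (hG.hTensor_symm hy) u v w
  have h2 := hG.covDeriv_schoutenShift_antisymm hσ hy u v w
  have hr : ∀ x, fderiv ℝ σ y (ricciSharp G y x) = ricci G y x (gradient G σ y) := fun x => by
    rw [← hG.apply_gradient hy, hG.symm y hy, hG.apply_ricciSharp hy]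
  -- `H` is `n - 2` times the Schouten tensor, so `(n - 2) C` is `(n - 2) R` minus the
  -- Kulkarni–Nomizu product of `H` and `G`.
  have hW : ((Module.finrank ℝ E : ℝ) - 2) * fderiv ℝ σ y (weyl G y u v w)
      = ((Module.finrank ℝ E : ℝ) - 2) * fderiv ℝ σ y (riemann G y u v w)
        + fderiv ℝ σ y v * hTensor G y u w - fderiv ℝ σ y u * hTensor G y v w
        + G y u w * hTensor G y v (gradient G σ y)
        - G y v w * hTensor G y u (gradient G σ y) := by
    simp only [weyl, if_neg (not_le.2 hn), hTensor, map_add, map_sub, map_smul,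
      _root_.sub_apply, _root_.smul_apply, smul_eq_mul, hr]
    rw [hG.symm y hy v (gradient G σ y), hG.symm y hy u (gradient G σ y),
      hG.apply_gradient hy, hG.apply_gradient hy]
    field_simp
    ring
  rw [codazziDefect, codazziDefect, hcov, hcov, hW]
  linear_combination h1 - ((Module.finrank ℝ E : ℝ) - 2) * h2

end IsMetricOn

/-! ### Dimension at most two -/

section LowDimension

variable {E : Type*} [NormedAddCommGroup E] [NormedSpace ℝ E] [FiniteDimensional ℝ E]

/-- The defect is antisymmetric in `u`, `v`, which are proportional here; the value of `H` plays no
role. -/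
theorem codazziDefect_of_finrank_le_one (hn : Module.finrank ℝ E ≤ 1)
    (G : E → E →L[ℝ] E →L[ℝ] ℝ) (y u v w : E) : codazziDefect G y u v w = 0 := by
  obtain ⟨x, hx⟩ := finrank_le_one_iff.1 hn
  obtain ⟨a, rfl⟩ := hx u
  obtain ⟨b, rfl⟩ := hx v
  simp only [codazziDefect, covDeriv, map_smul, _root_.smul_apply, smul_eq_mul]
  ring

/-- In dimension two the Riemann tensor is determined by the Ricci tensor. -/
theorem riemann_of_finrank_eq_two (hn : Module.finrank ℝ E = 2)
    (G : E → E →L[ℝ] E →L[ℝ] ℝ) (y u v w : E) :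
    riemann G y u v w = ricci G y v w • u - ricci G y u w • v := by
  let b : Module.Basis (Fin 2) ℝ E := Module.finBasisOfFinrankEq ℝ E hn
  have htr : ∀ A : E →ₗ[ℝ] E, LinearMap.trace ℝ E A = b.repr (A (b 0)) 0 + b.repr (A (b 1)) 1 := by
    intro A
    rw [LinearMap.trace_eq_matrix_trace ℝ b, Matrix.trace_fin_two, LinearMap.toMatrix_apply,
      LinearMap.toMatrix_apply]
  have hself : ∀ x z, riemann G y x x z = 0 := fun x z => by
    rw [riemann_apply]
    abel
  have hric : ∀ x z, ricci G y x z
      = b.repr (riemann G y (b 0) x z) 0 + b.repr (riemann G y (b 1) x z) 1 := fun x z => by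
    rw [ricci_apply, htr]
    rfl
  have h0 := hric (b 0) w
  have h1 := hric (b 1) w
  rw [hself, riemann_antisymm G y (b 1) (b 0)] at h0
  rw [hself] at h1
  -- In dimension two each Ricci trace has one nonzero term, so `h0` and `h1` read off both
  -- coordinates of `R(b₀, b₁) w`.
  have h01 : riemann G y (b 0) (b 1) w = ricci G y (b 1) w • b 0 - ricci G y (b 0) w • b 1 := by
    have h := b.sum_repr (riemann G y (b 0) (b 1) w)
    rw [Fin.sum_univ_two] at h
    rw [h0, h1]
    simpa using h.symm
  have h10 := riemann_antisymm G y (b 1) (b 0) w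
  rw [← b.sum_repr u, ← b.sum_repr v]
  simp only [Fin.sum_univ_two, map_add, map_smul, _root_.add_apply, _root_.smul_apply, hself, h10,
    h01, smul_eq_mul]
  module

variable {G : E → E →L[ℝ] E →L[ℝ] ℝ} {U : Set E} {y : E}

/-- Put the two-dimensional formula for `R` into its skewness and trace over `v`: this gives `2 Ric
= R G`, with `R` the scalar curvature. -/
theorem IsMetricOn.hTensor_of_finrank_eq_two (hG : IsMetricOn G U) (hy : y ∈ U)
    (hn : Module.finrank ℝ E = 2) : hTensor G y = 0 := by
  have key : ∀ v x w : E, ricci G y x w • v - ricci G y v w • x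
      = G y x w • ricciSharp G y v - G y v w • ricciSharp G y x := by
    intro v x w
    refine hG.ext hy fun z => ?_
    have h := hG.apply_riemann_skew hy v x w z
    rw [riemann_of_finrank_eq_two hn, riemann_of_finrank_eq_two hn] at h
    simp only [map_sub, map_smul, _root_.sub_apply, _root_.smul_apply, smul_eq_mul] at h
    simp only [map_sub, map_smul, _root_.sub_apply, _root_.smul_apply, smul_eq_mul,
      hG.apply_ricciSharp hy, h]
    rw [hG.symm y hy w v, hG.symm y hy w x]
    ring
  ext x w
  have h1 : ricci G y x w • LinearMap.id - ((ricci G y).flip w : E →ₗ[ℝ] ℝ).smulRight x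
      = G y x w • (ricciSharp G y : E →ₗ[ℝ] E)
        - ((G y).flip w : E →ₗ[ℝ] ℝ).smulRight (ricciSharp G y x) := by
    ext v
    simpa using key v x w
  have h2 := congrArg (LinearMap.trace ℝ E) h1
  simp only [map_sub, map_smul, LinearMap.trace_smulRight, LinearMap.trace_id, hn, smul_eq_mul,
    ContinuousLinearMap.coe_coe, ContinuousLinearMap.flip_apply, hG.apply_ricciSharp hy] at h2
  simp only [hTensor, scalar, hn, _root_.sub_apply, _root_.smul_apply, smul_eq_mul]
  norm_num at h2 ⊢
  linarith

theorem IsMetricOn.codazziDefect_of_finrank_le_two (hG : IsMetricOn G U) (hy : y ∈ U)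
    (hn : Module.finrank ℝ E ≤ 2) (u v w : E) : codazziDefect G y u v w = 0 := by
  rcases Nat.lt_or_ge 1 (Module.finrank ℝ E) with h | h
  · have hn : Module.finrank ℝ E = 2 := by omega
    have h0 : hTensor G =ᶠ[nhds y] fun _ => 0 := by
      filter_upwards [hG.isOpen.mem_nhds hy] with z hz using hG.hTensor_of_finrank_eq_two hz hn
    simp [codazziDefect, covDeriv, h0.fderiv_eq, h0.self_of_nhds]
  · exact codazziDefect_of_finrank_le_one h G y u v w

end LowDimension

/-! ### Products -/

section Product

/-- A presentation of `E` as the direct sum of `F` and `F'`, by its projections and inclusions. -/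
structure Splitting (E F F' : Type*) [NormedAddCommGroup E] [NormedSpace ℝ E]
    [NormedAddCommGroup F] [NormedSpace ℝ F] [NormedAddCommGroup F'] [NormedSpace ℝ F'] where
  p : E →L[ℝ] F
  p' : E →L[ℝ] F'
  i : F →L[ℝ] E
  i' : F' →L[ℝ] E
  p_i : ∀ v, p (i v) = v
  p'_i' : ∀ v, p' (i' v) = v
  p_i' : ∀ v, p (i' v) = 0
  p'_i : ∀ v, p' (i v) = 0
  add_eq : ∀ v, i (p v) + i' (p' v) = v

variable {E : Type*} [NormedAddCommGroup E] [NormedSpace ℝ E]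
  {F : Type*} [NormedAddCommGroup F] [NormedSpace ℝ F]
  {F' : Type*} [NormedAddCommGroup F'] [NormedSpace ℝ F']

/-- The product of the metrics `G` and `G'`. -/
def productMetric (s : Splitting E F F') (G : F → F →L[ℝ] F →L[ℝ] ℝ)
    (G' : F' → F' →L[ℝ] F' →L[ℝ] ℝ) : E → E →L[ℝ] E →L[ℝ] ℝ :=
  fun z => pullback (G (s.p z)) s.p + pullback (G' (s.p' z)) s.p'

@[simp]
theorem productMetric_apply (s : Splitting E F F') (G : F → F →L[ℝ] F →L[ℝ] ℝ)
    (G' : F' → F' →L[ℝ] F' →L[ℝ] ℝ) (z v w : E) :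
    productMetric s G G' z v w = G (s.p z) (s.p v) (s.p w) + G' (s.p' z) (s.p' v) (s.p' w) := by
  simp [productMetric, pullback]

/-- Cyclicity of the trace: `tr (i A p) = tr (A p i) = tr A`. -/
theorem trace_splitting [FiniteDimensional ℝ E] [FiniteDimensional ℝ F]
    [FiniteDimensional ℝ F'] (s : Splitting E F F') (A : F →L[ℝ] F) (A' : F' →L[ℝ] F')
    (B : E →L[ℝ] E) (h : ∀ v, B v = s.i (A (s.p v)) + s.i' (A' (s.p' v))) :
    LinearMap.trace ℝ E (B : E →ₗ[ℝ] E)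
      = LinearMap.trace ℝ F (A : F →ₗ[ℝ] F) + LinearMap.trace ℝ F' (A' : F' →ₗ[ℝ] F') := by
  have hB : (B : E →ₗ[ℝ] E) = (s.i : F →ₗ[ℝ] E) ∘ₗ ((A : F →ₗ[ℝ] F) ∘ₗ (s.p : E →ₗ[ℝ] F))
      + (s.i' : F' →ₗ[ℝ] E) ∘ₗ ((A' : F' →ₗ[ℝ] F') ∘ₗ (s.p' : E →ₗ[ℝ] F')) := by
    ext v
    simpa using h v
  rw [hB, map_add, LinearMap.trace_comp_comm', LinearMap.trace_comp_comm' _ (s.i' : F' →ₗ[ℝ] E)]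
  congr 2
  · ext v
    simp [s.p_i]
  · ext v
    simp [s.p'_i']

namespace IsMetricOn

variable {s : Splitting E F F'} {G : F → F →L[ℝ] F →L[ℝ] ℝ} {U : Set F}
    {G' : F' → F' →L[ℝ] F' →L[ℝ] ℝ} {U' : Set F'} {y : E}

variable [FiniteDimensional ℝ E]

theorem product (s : Splitting E F F') (hG : IsMetricOn G U) (hG' : IsMetricOn G' U') :
    IsMetricOn (productMetric s G G') (s.p ⁻¹' U ∩ s.p' ⁻¹' U') where
  isOpen := (hG.isOpen.preimage s.p.continuous).inter (hG'.isOpen.preimage s.p'.continuous)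
  contDiffOn := by
    simp only [contDiffOn_clm_apply, productMetric_apply]
    intro v w
    have h1 : ContDiffOn ℝ ∞ (fun z => G (s.p z)) (s.p ⁻¹' U ∩ s.p' ⁻¹' U') :=
      hG.contDiffOn.comp s.p.contDiff.contDiffOn fun z hz => hz.1
    have h2 : ContDiffOn ℝ ∞ (fun z => G' (s.p' z)) (s.p ⁻¹' U ∩ s.p' ⁻¹' U') :=
      hG'.contDiffOn.comp s.p'.contDiff.contDiffOn fun z hz => hz.2
    exact ((h1.clm_apply contDiffOn_const).clm_apply contDiffOn_const).add
      ((h2.clm_apply contDiffOn_const).clm_apply contDiffOn_const)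
  symm y hy v w := by simp [hG.symm _ hy.1 (s.p v), hG'.symm _ hy.2 (s.p' v)]
  nondegenerate y hy v hv := by
    have h1 : s.p v = 0 := hG.nondegenerate _ hy.1 _ fun w => by
      simpa [s.p_i, s.p'_i] using hv (s.i w)
    have h2 : s.p' v = 0 := hG'.nondegenerate _ hy.2 _ fun w => by
      simpa [s.p_i', s.p'_i'] using hv (s.i' w)
    rw [← s.add_eq v, h1, h2, map_zero, map_zero, add_zero]

theorem fderiv_product (hG : IsMetricOn G U) (hG' : IsMetricOn G' U')
    (hy : s.p y ∈ U) (hy' : s.p' y ∈ U') (u v w : E) :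
    fderiv ℝ (productMetric s G G') y u v w
      = fderiv ℝ G (s.p y) (s.p u) (s.p v) (s.p w)
        + fderiv ℝ G' (s.p' y) (s.p' u) (s.p' v) (s.p' w) := by
  rw [← fderiv_apply_const₂ ((product s hG hG').differentiableAt ⟨hy, hy'⟩)]
  simp only [productMetric_apply]
  have d1 := ((hG.differentiableAt hy).hasFDerivAt.comp y s.p.hasFDerivAt)
  have d2 := ((hG'.differentiableAt hy').hasFDerivAt.comp y s.p'.hasFDerivAt)
  have e1 := (d1.clm_apply (hasFDerivAt_const (s.p v) y)).clm_apply (hasFDerivAt_const (s.p w) y)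
  have e2 := (d2.clm_apply (hasFDerivAt_const (s.p' v) y)).clm_apply
    (hasFDerivAt_const (s.p' w) y)
  have := (e1.fun_add e2).fderiv
  simp only [Function.comp_apply] at this
  rw [this]
  simp

variable [FiniteDimensional ℝ F] [FiniteDimensional ℝ F']

theorem christoffel_product (hG : IsMetricOn G U) (hG' : IsMetricOn G' U')
    (hy : s.p y ∈ U) (hy' : s.p' y ∈ U') (u v : E) :
    christoffel (productMetric s G G') y u v
      = s.i (christoffel G (s.p y) (s.p u) (s.p v))
        + s.i' (christoffel G' (s.p' y) (s.p' u) (s.p' v)) := by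
  refine (product s hG hG').ext (y := y) ⟨hy, hy'⟩ fun w => ?_
  rw [(product s hG hG').apply_christoffel ⟨hy, hy'⟩]
  simp only [fderiv_product hG hG' hy hy', productMetric_apply, map_add, _root_.add_apply, s.p_i, s.p_i', s.p'_i,
    s.p'_i', map_zero, _root_.zero_apply, add_zero, zero_add, hG.apply_christoffel hy,
    hG'.apply_christoffel hy']
  ring

theorem fderiv_christoffel_product (hG : IsMetricOn G U) (hG' : IsMetricOn G' U')
    (hy : s.p y ∈ U) (hy' : s.p' y ∈ U') (u v w : E) :
    fderiv ℝ (christoffel (productMetric s G G')) y u v w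
      = s.i (fderiv ℝ (christoffel G) (s.p y) (s.p u) (s.p v) (s.p w))
        + s.i' (fderiv ℝ (christoffel G') (s.p' y) (s.p' u) (s.p' v) (s.p' w)) := by
  rw [← fderiv_apply_const₂ ((product s hG hG').differentiableAt_christoffel ⟨hy, hy'⟩)]
  have : (fun z => christoffel (productMetric s G G') z v w) =ᶠ[nhds y]
      fun z => s.i (christoffel G (s.p z) (s.p v) (s.p w))
        + s.i' (christoffel G' (s.p' z) (s.p' v) (s.p' w)) := by
    filter_upwards [(product s hG hG').isOpen.mem_nhds ⟨hy, hy'⟩] with z hz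
      using christoffel_product hG hG' hz.1 hz.2 v w
  rw [this.fderiv_eq]
  have d1 := ((hG.differentiableAt_christoffel hy).hasFDerivAt.comp y s.p.hasFDerivAt)
  have d2 := ((hG'.differentiableAt_christoffel hy').hasFDerivAt.comp y s.p'.hasFDerivAt)
  have e1 := s.i.hasFDerivAt.comp y
    ((d1.clm_apply (hasFDerivAt_const (s.p v) y)).clm_apply (hasFDerivAt_const (s.p w) y))
  have e2 := s.i'.hasFDerivAt.comp y ((d2.clm_apply (hasFDerivAt_const (s.p' v) y)).clm_apply
    (hasFDerivAt_const (s.p' w) y))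
  have := (e1.fun_add e2).fderiv
  simp only [Function.comp_apply] at this
  rw [this]
  simp

theorem riemann_product (hG : IsMetricOn G U) (hG' : IsMetricOn G' U')
    (hy : s.p y ∈ U) (hy' : s.p' y ∈ U') (u v w : E) :
    riemann (productMetric s G G') y u v w
      = s.i (riemann G (s.p y) (s.p u) (s.p v) (s.p w))
        + s.i' (riemann G' (s.p' y) (s.p' u) (s.p' v) (s.p' w)) := by
  simp only [riemann_apply, fderiv_christoffel_product hG hG' hy hy',
    christoffel_product hG hG' hy hy', map_add, map_sub, s.p_i, s.p_i', s.p'_i, s.p'_i',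
    add_zero, zero_add]
  abel

theorem ricci_product (hG : IsMetricOn G U) (hG' : IsMetricOn G' U')
    (hy : s.p y ∈ U) (hy' : s.p' y ∈ U') (v w : E) :
    ricci (productMetric s G G') y v w
      = ricci G (s.p y) (s.p v) (s.p w) + ricci G' (s.p' y) (s.p' v) (s.p' w) := by
  simp only [ricci_apply]
  exact trace_splitting s _ _ _ fun u => by simp [riemann_product hG hG' hy hy']

theorem ricciSharp_product (hG : IsMetricOn G U) (hG' : IsMetricOn G' U')
    (hy : s.p y ∈ U) (hy' : s.p' y ∈ U') (v : E) :
    ricciSharp (productMetric s G G') y v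
      = s.i (ricciSharp G (s.p y) (s.p v)) + s.i' (ricciSharp G' (s.p' y) (s.p' v)) := by
  refine (product s hG hG').inverse_eq (y := y) ⟨hy, hy'⟩
    (a := ricci (productMetric s G G') y v) fun w => ?_
  simp [ricci_product hG hG' hy hy', s.p_i, s.p_i', s.p'_i, s.p'_i', hG.apply_ricciSharp hy,
    hG'.apply_ricciSharp hy']

theorem scalar_product (hG : IsMetricOn G U) (hG' : IsMetricOn G' U')
    (hy : s.p y ∈ U) (hy' : s.p' y ∈ U') :
    scalar (productMetric s G G') y = scalar G (s.p y) + scalar G' (s.p' y) :=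
  trace_splitting s _ _ _ fun v => ricciSharp_product hG hG' hy hy' v

theorem hTensor_product (hG : IsMetricOn G U) (hG' : IsMetricOn G' U')
    (hy : s.p y ∈ U) (hy' : s.p' y ∈ U') (v w : F) :
    hTensor (productMetric s G G') y (s.i v) (s.i w)
      = ricci G (s.p y) v w - (scalar G (s.p y) + scalar G' (s.p' y))
        / (2 * ((Module.finrank ℝ E : ℝ) - 1)) * G (s.p y) v w := by
  simp [hTensor, ricci_product hG hG' hy hy', scalar_product hG hG' hy hy', s.p_i, s.p'_i]

end IsMetricOn

end Product

/-! ### Logarithmic conformal factors, locality of the curvature, and parallel multiples of the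
metric -/

section Congruence

open Filter Topology

variable {E : Type*} [NormedAddCommGroup E] [NormedSpace ℝ E]
  {G G' : E → E →L[ℝ] E →L[ℝ] ℝ} {U : Set E} {y : E}

theorem IsMetricOn.congr (hG : IsMetricOn G U) (h : ∀ z ∈ U, G' z = G z) : IsMetricOn G' U where
  isOpen := hG.isOpen
  contDiffOn := hG.contDiffOn.congr h
  symm y hy v w := by rw [h y hy, hG.symm y hy]
  nondegenerate y hy v hv := hG.nondegenerate y hy v (by rwa [h y hy] at hv)

theorem exp_two_mul_neg_log {a : ℝ} (ha : 0 < a) : Real.exp (2 * -Real.log a) = (a ^ 2)⁻¹ := by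
  rw [mul_neg, Real.exp_neg, two_mul, Real.exp_add, Real.exp_log ha, sq]

theorem contDiffOn_neg_log {f : E → ℝ} (hf : ContDiffOn ℝ ∞ f U) (hf0 : ∀ z ∈ U, 0 < f z) :
    ContDiffOn ℝ ∞ (fun z => -Real.log (f z)) U :=
  (hf.log fun z hz => (hf0 z hz).ne').neg

theorem fderiv_neg_log {f : E → ℝ} {z : E} (hf : DifferentiableAt ℝ f z) (hf0 : 0 < f z) (v : E) :
    fderiv ℝ (fun z => -Real.log (f z)) z v = -((f z)⁻¹ * fderiv ℝ f z v) := by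
  rw [fderiv_fun_neg, fderiv.log hf hf0.ne']
  simp

theorem christoffel_eventuallyEq (h : G =ᶠ[𝓝 y] G') : christoffel G =ᶠ[𝓝 y] christoffel G' := by
  filter_upwards [h, h.fderiv (𝕜 := ℝ)] with z hz hz'
  rw [christoffel, christoffel, koszul, koszul, hz, hz']

theorem riemann_eventuallyEq (h : G =ᶠ[𝓝 y] G') : riemann G =ᶠ[𝓝 y] riemann G' := by
  have hΓ := christoffel_eventuallyEq h
  filter_upwards [hΓ, hΓ.fderiv (𝕜 := ℝ)] with z hz hz'
  rw [riemann, riemann, riemannAux, riemannAux, hz, hz']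

variable [FiniteDimensional ℝ E]

theorem ricci_eventuallyEq (h : G =ᶠ[𝓝 y] G') : ricci G =ᶠ[𝓝 y] ricci G' := by
  filter_upwards [riemann_eventuallyEq h] with z hz
  rw [ricci, ricci, hz]

theorem scalar_eventuallyEq (h : G =ᶠ[𝓝 y] G') : scalar G =ᶠ[𝓝 y] scalar G' := by
  filter_upwards [h, ricci_eventuallyEq h] with z hz hz'
  rw [scalar, scalar, ricciSharp, ricciSharp, hz, hz']

theorem hTensor_eventuallyEq (h : G =ᶠ[𝓝 y] G') : hTensor G =ᶠ[𝓝 y] hTensor G' := by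
  filter_upwards [h, ricci_eventuallyEq h, scalar_eventuallyEq h] with z hz hz' hz''
  rw [hTensor, hTensor, hz, hz', hz'']

theorem codazziDefect_congr (h : G =ᶠ[𝓝 y] G') (u v w : E) :
    codazziDefect G y u v w = codazziDefect G' y u v w := by
  have hH := hTensor_eventuallyEq h
  simp only [codazziDefect, covDeriv, hH.fderiv_eq, hH.self_of_nhds,
    (christoffel_eventuallyEq h).self_of_nhds]

theorem IsMetricOn.covDeriv_sub_smul_self (hG : IsMetricOn G U) (hy : y ∈ U)
    {T S : E → E →L[ℝ] E →L[ℝ] ℝ} (hT : DifferentiableAt ℝ T y) {κ : ℝ}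
    (h : S =ᶠ[𝓝 y] fun z => T z - κ • G z) (u v w : E) :
    covDeriv G S y u v w = covDeriv G T y u v w := by
  have h0 := hG.covDeriv_self hy u v w
  have hGd := hG.differentiableAt hy
  simp only [covDeriv] at h0 ⊢
  rw [h.fderiv_eq, h.self_of_nhds, fderiv_fun_sub hT (hGd.fun_const_smul κ),
    fderiv_fun_const_smul hGd]
  simp only [_root_.sub_apply, _root_.smul_apply, smul_eq_mul]
  linear_combination (-κ) * h0

/-- `H` and `Ric` differ by a constant multiple of the parallel tensor `G`. -/
theorem IsMetricOn.covDeriv_hTensor_of_scalar_eq_const (hG : IsMetricOn G U) (hy : y ∈ U) {c : ℝ}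
    (hc : ∀ z ∈ U, scalar G z = c) (u v w : E) :
    covDeriv G (hTensor G) y u v w = covDeriv G (ricci G) y u v w := by
  refine hG.covDeriv_sub_smul_self hy
    (differentiableAt_of_contDiffOn hG.isOpen hG.contDiffOn_ricci hy)
    (κ := c / (2 * ((Module.finrank ℝ E : ℝ) - 1))) ?_ u v w
  filter_upwards [hG.isOpen.mem_nhds hy] with z hz
  rw [hTensor, hc z hz]

end Congruence

/-! ### The theorem on open sets of vector spaces -/

section DoublyWarped

variable {E : Type*} [NormedAddCommGroup E] [NormedSpace ℝ E] [FiniteDimensional ℝ E]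
  {F : Type*} [NormedAddCommGroup F] [NormedSpace ℝ F] [FiniteDimensional ℝ F]
  {F' : Type*} [NormedAddCommGroup F'] [NormedSpace ℝ F'] [FiniteDimensional ℝ F']
  {s : Splitting E F F'} {G : F → F →L[ℝ] F →L[ℝ] ℝ} {U : Set F}
  {G' : F' → F' →L[ℝ] F' →L[ℝ] ℝ} {U' : Set F'} {y : E}

/-- Along the first factor the scalar curvature of the product does not vary: one summand is
constant, the other depends on the other factor only. So the `G` part of `H` is parallel, and the
mismatch between the dimensions of `E` and `F` is harmless. -/
theorem IsMetricOn.covDeriv_hTensor_product (hG : IsMetricOn G U) (hG' : IsMetricOn G' U')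
    (hy : s.p y ∈ U) (hy' : s.p' y ∈ U') {c : ℝ} (hc : ∀ z ∈ U, scalar G z = c) (u v w : F) :
    covDeriv (productMetric s G G') (hTensor (productMetric s G G')) y (s.i u) (s.i v) (s.i w)
      = covDeriv G (ricci G) (s.p y) u v w := by
  have hP := product s hG hG'
  have h0 := hG.covDeriv_self hy u v w
  have hd : fderiv ℝ (hTensor (productMetric s G G')) y (s.i u) (s.i v) (s.i w)
      = fderiv ℝ (ricci G) (s.p y) u v w - (c + scalar G' (s.p' y))
        / (2 * ((Module.finrank ℝ E : ℝ) - 1)) * fderiv ℝ G (s.p y) u v w := by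
    rw [← fderiv_apply_const₂
      (differentiableAt_of_contDiffOn hP.isOpen hP.contDiffOn_hTensor ⟨hy, hy'⟩)]
    have heq : (fun z => hTensor (productMetric s G G') z (s.i v) (s.i w)) =ᶠ[nhds y]
        fun z => ricci G (s.p z) v w - (c + scalar G' (s.p' z))
          * (2 * ((Module.finrank ℝ E : ℝ) - 1))⁻¹ * G (s.p z) v w := by
      filter_upwards [hP.isOpen.mem_nhds ⟨hy, hy'⟩] with z hz
      rw [hG.hTensor_product hG' hz.1 hz.2, hc _ hz.1, div_eq_mul_inv]
    have d1 := ((differentiableAt_of_contDiffOn hG.isOpen hG.contDiffOn_ricci hy).hasFDerivAt.comp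
      y s.p.hasFDerivAt)
    have d2 := ((differentiableAt_of_contDiffOn hG'.isOpen hG'.contDiffOn_scalar
      hy').hasFDerivAt.comp y s.p'.hasFDerivAt)
    have d3 := ((hG.differentiableAt hy).hasFDerivAt.comp y s.p.hasFDerivAt)
    have e1 := (d1.clm_apply (hasFDerivAt_const v y)).clm_apply (hasFDerivAt_const w y)
    have e2 := (d2.const_add c).mul_const (2 * ((Module.finrank ℝ E : ℝ) - 1))⁻¹
    have e3 := (d3.clm_apply (hasFDerivAt_const v y)).clm_apply (hasFDerivAt_const w y)
    have hf := (e1.fun_sub (e2.fun_mul e3)).fderiv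
    simp only [Function.comp_apply] at hf
    rw [heq.fderiv_eq, hf]
    simp [s.p_i, s.p'_i, div_eq_mul_inv]
  have hΓ : ∀ a b, christoffel (productMetric s G G') y (s.i a) (s.i b)
      = s.i (christoffel G (s.p y) a b) := fun a b => by
    simp [hG.christoffel_product hG' hy hy', s.p_i, s.p'_i]
  simp only [covDeriv] at h0 ⊢
  rw [hd, hΓ, hΓ, hG.hTensor_product hG' hy hy', hG.hTensor_product hG' hy hy', hc _ hy]
  linear_combination -((c + scalar G' (s.p' y)) / (2 * ((Module.finrank ℝ E : ℝ) - 1))) * h0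

theorem IsMetricOn.codazziDefect_product (hG : IsMetricOn G U) (hG' : IsMetricOn G' U')
    (hy : s.p y ∈ U) (hy' : s.p' y ∈ U') {c : ℝ} (hc : ∀ z ∈ U, scalar G z = c) (u v w : F) :
    codazziDefect (productMetric s G G') y (s.i u) (s.i v) (s.i w)
      = codazziDefect G (s.p y) u v w := by
  rw [codazziDefect, codazziDefect, hG.covDeriv_hTensor_product hG' hy hy' hc,
    hG.covDeriv_hTensor_product hG' hy hy' hc, hG.covDeriv_hTensor_of_scalar_eq_const hy hc,
    hG.covDeriv_hTensor_of_scalar_eq_const hy hc]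

/-- Two conformal changes, from `K` to the product metric and from the first factor of that product
to `G`. The hypotheses on the defect and the Weyl tensor of `K` enter at the single point `y`, and
the equivalence is pointwise too. -/
theorem codazziDefect_eq_zero_iff_of_doublyWarped (hG : IsMetricOn G U) (hG' : IsMetricOn G' U')
    {f : F → ℝ} (hf : ContDiffOn ℝ ∞ f U) (hf0 : ∀ z ∈ U, 0 < f z)
    {f' : F' → ℝ} (hf' : ContDiffOn ℝ ∞ f' U') (hf0' : ∀ z ∈ U', 0 < f' z)
    {K : E → E →L[ℝ] E →L[ℝ] ℝ}
    (hK : ∀ z, s.p z ∈ U → s.p' z ∈ U' → ∀ v w, K z v w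
      = f' (s.p' z) ^ 2 * G (s.p z) (s.p v) (s.p w)
        + f (s.p z) ^ 2 * G' (s.p' z) (s.p' v) (s.p' w))
    (hy : s.p y ∈ U) (hy' : s.p' y ∈ U')
    (hcod : ∀ u v w, codazziDefect K y u v w = 0)
    (hφ : ∀ u v w, fderiv ℝ (fun z => f (s.p z) * f' (s.p' z)) y (weyl K y u v w) = 0)
    {c : ℝ} (hc : ∀ z ∈ U, scalar (fun x => (f x ^ 2)⁻¹ • G x) z = c) :
    (∀ u v w, codazziDefect G (s.p y) u v w = 0)
      ↔ ∀ u v w, fderiv ℝ f (s.p y) (weyl G (s.p y) u v w) = 0 := by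
  rcases Nat.lt_or_ge 2 (Module.finrank ℝ F) with hn | hn
  swap
  -- In dimension at most two the defect vanishes, and the Weyl tensor is zero by convention.
  · exact iff_of_true (hG.codazziDefect_of_finrank_le_two hy hn) fun u v w => by
      simp [weyl, hn]
  have hnE : 2 < Module.finrank ℝ E := hn.trans_le <|
    LinearMap.finrank_le_finrank_of_injective (f := (s.i : F →ₗ[ℝ] E))
      (Function.LeftInverse.injective (g := s.p) s.p_i)
  have hn2 : (2 : ℝ) < Module.finrank ℝ F := mod_cast hn
  set σ : F → ℝ := fun z => -Real.log (f z) with hσdef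
  set σ' : F' → ℝ := fun z => -Real.log (f' z) with hσdef'
  have hσ := contDiffOn_neg_log hf hf0
  have hσ' := contDiffOn_neg_log hf' hf0'
  have hS := hG.expScale hσ
  have hS' := hG'.expScale hσ'
  have hP := IsMetricOn.product s hS hS'
  have hc' : ∀ z ∈ U, scalar (expScale σ G) z = c := fun z hz => by
    rw [← hc z hz]
    refine (scalar_eventuallyEq ?_).self_of_nhds
    filter_upwards [hG.isOpen.mem_nhds hz] with x hx
    rw [expScale, exp_two_mul_neg_log (hf0 x hx)]
  set W : Set E := s.p ⁻¹' U ∩ s.p' ⁻¹' U' with hW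
  have hyW : y ∈ W := ⟨hy, hy'⟩
  have hWo : IsOpen W := hP.isOpen
  have hF : ContDiffOn ℝ ∞ (fun z => f (s.p z) * f' (s.p' z)) W :=
    (hf.comp s.p.contDiff.contDiffOn fun z hz => hz.1).mul
      (hf'.comp s.p'.contDiff.contDiffOn fun z hz => hz.2)
  have hF0 : ∀ z ∈ W, 0 < f (s.p z) * f' (s.p' z) := fun z hz =>
    mul_pos (hf0 _ hz.1) (hf0' _ hz.2)
  have hτ := contDiffOn_neg_log hF hF0
  -- Writing `K` as a conformal multiple of the product shows that it is a metric, which the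
  -- conformal formula for `K` requires.
  have hKP : ∀ z ∈ W, K z = expScale (fun z => -(-Real.log (f (s.p z) * f' (s.p' z))))
      (productMetric s (expScale σ G) (expScale σ' G')) z := fun z hz => by
    have h1 := hf0 _ hz.1
    have h2 := hf0' _ hz.2
    ext v w
    rw [hK z hz.1 hz.2, expScale, mul_neg, Real.exp_neg, exp_two_mul_neg_log (hF0 z hz)]
    simp only [_root_.smul_apply, productMetric_apply, expScale, smul_eq_mul, hσdef, hσdef',
      exp_two_mul_neg_log h1, exp_two_mul_neg_log h2]
    field_simp
  have hKm : IsMetricOn K W := (hP.expScale hτ.neg).congr hKP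
  have hPK : expScale (fun z => -Real.log (f (s.p z) * f' (s.p' z))) K =ᶠ[nhds y]
      productMetric s (expScale σ G) (expScale σ' G') := by
    filter_upwards [hWo.mem_nhds hyW] with z hz
    rw [expScale, hKP z hz, expScale, smul_smul, ← Real.exp_add]
    simp
  -- The product is `K` rescaled by `τ = -log (f f')`; `dτ` is proportional to `d(f f')`, so the
  -- Weyl term vanishes by `hφ`.
  have hzero : ∀ u v w, codazziDefect (expScale σ G) (s.p y) u v w = 0 := fun u v w => by
    rw [← hS.codazziDefect_product hS' hy hy' hc', ← codazziDefect_congr hPK,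
      hKm.codazziDefect_expScale hτ hyW hnE, hcod,
      fderiv_neg_log (differentiableAt_of_contDiffOn hWo hF hyW) (hF0 y hyW), hφ]
    simp
  have hfy := hf0 _ hy
  have key : ∀ u v w, codazziDefect G (s.p y) u v w = ((Module.finrank ℝ F : ℝ) - 2)
      * ((f (s.p y))⁻¹ * fderiv ℝ f (s.p y) (weyl G (s.p y) u v w)) := fun u v w => by
    have h := hG.codazziDefect_expScale hσ hy hn u v w
    rw [hzero, fderiv_neg_log (differentiableAt_of_contDiffOn hG.isOpen hf hy) hfy] at h
    linarith
  have hne : (Module.finrank ℝ F : ℝ) - 2 ≠ 0 := by linarith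
  simp only [key, mul_eq_zero, hne, inv_eq_zero, hfy.ne', false_or]

end DoublyWarped

end LocalMetric

/-! ### From manifolds to charts -/

section Charts

variable {E : Type*} [NormedAddCommGroup E] [NormedSpace ℝ E]
  {M : Type*} [TopologicalSpace M] [ChartedSpace E M]
  {e : OpenPartialHomeomorph M E}

theorem contMDiffOn_extend_symm_target {H : Type*} [TopologicalSpace H]
    {I : ModelWithCorners ℝ E H} {N : Type*} [TopologicalSpace N] [ChartedSpace H N]
    {e : OpenPartialHomeomorph N H} (he : e ∈ IsManifold.maximalAtlas I ∞ N) :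
    ContMDiffOn 𝓘(ℝ, E) I ∞ (e.extend I).symm (e.extend I).target := by
  rw [e.extend_target']
  exact contMDiffOn_extend_symm he

theorem inChart_apply (I : ModelWithCorners ℝ E E) (g : BilinField I M)
    (e : OpenPartialHomeomorph M E) (y v w : E) :
    inChart I g e y v w = g ((e.extend I).symm y)
      (mfderiv 𝓘(ℝ, E) I (e.extend I).symm y v) (mfderiv 𝓘(ℝ, E) I (e.extend I).symm y w) :=
  rfl

theorem contDiffOn_comp_extend_symm (he : e ∈ IsManifold.maximalAtlas 𝓘(ℝ, E) ∞ M) {f : M → ℝ}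
    (hf : ContMDiff 𝓘(ℝ, E) 𝓘(ℝ, ℝ) ∞ f) :
    ContDiffOn ℝ ∞ (fun y => f ((e.extend 𝓘(ℝ, E)).symm y)) (e.extend 𝓘(ℝ, E)).target :=
  (hf.comp_contMDiffOn (contMDiffOn_extend_symm_target he)).contDiffOn

variable [IsManifold 𝓘(ℝ, E) ∞ M]

theorem contMDiffAt_mfderiv_extend_symm (he : e ∈ IsManifold.maximalAtlas 𝓘(ℝ, E) ∞ M)
    {y : E} (hy : y ∈ (e.extend 𝓘(ℝ, E)).target) (v : E) :
    ContMDiffAt 𝓘(ℝ, E) (𝓘(ℝ, E).prod 𝓘(ℝ, E)) ∞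
      (fun z : E => Bundle.TotalSpace.mk' E (E := TangentSpace 𝓘(ℝ, E) (M := M))
        ((e.extend 𝓘(ℝ, E)).symm z) (mfderiv 𝓘(ℝ, E) 𝓘(ℝ, E) (e.extend 𝓘(ℝ, E)).symm z v)) y := by
  have hs : ContMDiffAt 𝓘(ℝ, E) 𝓘(ℝ, E) ∞ (e.extend 𝓘(ℝ, E)).symm y :=
    (contMDiffOn_extend_symm_target he).contMDiffAt (e.isOpen_extend_target.mem_nhds hy)
  have := IsManifold.of_le (I := 𝓘(ℝ, E)) (M := M) (m := 1) (n := ∞) (by simp)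
  have hϕ := hs.mfderiv_const (m := ∞) (by simp)
  have hv : ContMDiffAt 𝓘(ℝ, E) (𝓘(ℝ, E).prod 𝓘(ℝ, E)) ∞
      (fun z : E => Bundle.TotalSpace.mk' E (E := TangentSpace 𝓘(ℝ, E) (M := E)) z v) y :=
    contMDiffAt_vectorSpace_iff_contDiffAt.2 contDiffAt_const
  exact ContMDiffAt.clm_apply_of_inCoordinates hϕ hv hs

theorem IsPseudoRiemannianMetric.isMetricOn_inChart [FiniteDimensional ℝ E]
    {g : BilinField 𝓘(ℝ, E) M}
    (hg : IsPseudoRiemannianMetric 𝓘(ℝ, E) g)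
    (he : e ∈ IsManifold.maximalAtlas 𝓘(ℝ, E) ∞ M) :
    LocalMetric.IsMetricOn (inChart 𝓘(ℝ, E) g e) (e.extend 𝓘(ℝ, E)).target where
  isOpen := e.isOpen_extend_target
  contDiffOn := by
    simp only [contDiffOn_clm_apply]
    intro v w y hy
    have hs : ContMDiffAt 𝓘(ℝ, E) 𝓘(ℝ, E) ∞ (e.extend 𝓘(ℝ, E)).symm y :=
      (contMDiffOn_extend_symm_target he).contMDiffAt (e.isOpen_extend_target.mem_nhds hy)
    have h : ContMDiffAt 𝓘(ℝ, E) (𝓘(ℝ, E).prod 𝓘(ℝ)) ∞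
        (fun z : E => Bundle.TotalSpace.mk' ℝ (E := Bundle.Trivial M ℝ)
          ((e.extend 𝓘(ℝ, E)).symm z) (g ((e.extend 𝓘(ℝ, E)).symm z)
            (mfderiv 𝓘(ℝ, E) 𝓘(ℝ, E) (e.extend 𝓘(ℝ, E)).symm z v)
            (mfderiv 𝓘(ℝ, E) 𝓘(ℝ, E) (e.extend 𝓘(ℝ, E)).symm z w))) y := by
      apply ContMDiffAt.clm_bundle_apply₂ (F₁ := E) (F₂ := E)
      · exact hg.contMDiff.contMDiffAt.comp y hs
      · exact contMDiffAt_mfderiv_extend_symm he hy v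
      · exact contMDiffAt_mfderiv_extend_symm he hy w
    -- In the trivial line bundle the fibre component of a section is the function itself.
    simp only [Bundle.contMDiffAt_totalSpace] at h
    have h2 := h.2.contDiffAt
    refine ContDiffAt.contDiffWithinAt ?_
    refine h2.congr_of_eventuallyEq (Filter.Eventually.of_forall fun z => ?_)
    rfl
  symm y hy v w := by rw [inChart_apply, inChart_apply, hg.symm]
  nondegenerate y hy v hv := by
    let x := (e.extend 𝓘(ℝ, E)).symm y
    have hxs : x ∈ (e.extend 𝓘(ℝ, E)).source := (e.extend 𝓘(ℝ, E)).map_target hy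
    have hxs' : x ∈ e.source := by rwa [e.extend_source] at hxs
    have hs : MDifferentiableAt 𝓘(ℝ, E) 𝓘(ℝ, E) (e.extend 𝓘(ℝ, E)).symm y :=
      ((contMDiffOn_extend_symm_target he).contMDiffAt
        (e.isOpen_extend_target.mem_nhds hy)).mdifferentiableAt (by simp)
    have hd : MDifferentiableAt 𝓘(ℝ, E) 𝓘(ℝ, E) (e.extend 𝓘(ℝ, E)) x :=
      (e.contMDiffAt_extend he hxs').mdifferentiableAt (by simp)
    let D : E →L[ℝ] E := mfderiv 𝓘(ℝ, E) 𝓘(ℝ, E) (e.extend 𝓘(ℝ, E)).symm y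
    let D' : E →L[ℝ] E := mfderiv 𝓘(ℝ, E) 𝓘(ℝ, E) (e.extend 𝓘(ℝ, E)) x
    have hid : (e.extend 𝓘(ℝ, E)) ∘ (e.extend 𝓘(ℝ, E)).symm =ᶠ[nhds y] id := by
      filter_upwards [e.isOpen_extend_target.mem_nhds hy] with z hz
      exact (e.extend 𝓘(ℝ, E)).right_inv hz
    -- The chain rule for chart after inverse chart makes `D` injective, hence bijective by
    -- dimension; nondegeneracy then passes through the pullback.
    have hDD : D'.comp D = ContinuousLinearMap.id ℝ E :=
      hasMFDerivAt_unique (hd.hasMFDerivAt.comp y hs.hasMFDerivAt)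
        ((hasMFDerivAt_id y).congr_of_eventuallyEq hid)
    have hinj : Function.Injective (D : E →ₗ[ℝ] E) :=
      Function.LeftInverse.injective (g := D') fun v => DFunLike.congr_fun hDD v
    have hsurj := LinearMap.injective_iff_surjective.1 hinj
    refine hinj ((hg.nondegenerate x (D v) fun w => ?_).trans (map_zero D).symm)
    obtain ⟨w, rfl⟩ := hsurj w
    exact hv w

end Charts

/-- The inverse of a product chart commutes with the projections, so its derivative acts factor by
factor. -/
theorem inChart_doublyWarpedMetric
    {E₁ : Type*} [NormedAddCommGroup E₁] [NormedSpace ℝ E₁]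
    {M₁ : Type*} [TopologicalSpace M₁] [ChartedSpace E₁ M₁] [IsManifold 𝓘(ℝ, E₁) ∞ M₁]
    {E₂ : Type*} [NormedAddCommGroup E₂] [NormedSpace ℝ E₂]
    {M₂ : Type*} [TopologicalSpace M₂] [ChartedSpace E₂ M₂] [IsManifold 𝓘(ℝ, E₂) ∞ M₂]
    (g₁ : BilinField 𝓘(ℝ, E₁) M₁) (g₂ : BilinField 𝓘(ℝ, E₂) M₂) (f₁ : M₁ → ℝ) (f₂ : M₂ → ℝ)
    {e₁ : OpenPartialHomeomorph M₁ E₁} (he₁ : e₁ ∈ IsManifold.maximalAtlas 𝓘(ℝ, E₁) ∞ M₁)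
    {e₂ : OpenPartialHomeomorph M₂ E₂} (he₂ : e₂ ∈ IsManifold.maximalAtlas 𝓘(ℝ, E₂) ∞ M₂)
    {z : E₁ × E₂} (h₁ : z.1 ∈ (e₁.extend 𝓘(ℝ, E₁)).target)
    (h₂ : z.2 ∈ (e₂.extend 𝓘(ℝ, E₂)).target) (v w : E₁ × E₂) :
    inChart (𝓘(ℝ, E₁).prod 𝓘(ℝ, E₂))
        (doublyWarpedMetric 𝓘(ℝ, E₁) 𝓘(ℝ, E₂) g₁ g₂ f₁ f₂) (e₁.prod e₂) z v w
      = f₂ ((e₂.extend 𝓘(ℝ, E₂)).symm z.2) ^ 2 * inChart 𝓘(ℝ, E₁) g₁ e₁ z.1 v.1 w.1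
        + f₁ ((e₁.extend 𝓘(ℝ, E₁)).symm z.1) ^ 2 * inChart 𝓘(ℝ, E₂) g₂ e₂ z.2 v.2 w.2 := by
  have he := IsManifold.mem_maximalAtlas_prod he₁ he₂
  have hz : z ∈ ((e₁.prod e₂).extend (𝓘(ℝ, E₁).prod 𝓘(ℝ, E₂))).target := by
    rw [OpenPartialHomeomorph.extend_prod]
    exact ⟨h₁, h₂⟩
  have ho : IsOpen ((e₁.prod e₂).extend (𝓘(ℝ, E₁).prod 𝓘(ℝ, E₂))).target := by
    rw [OpenPartialHomeomorph.extend_prod]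
    exact e₁.isOpen_extend_target.prod e₂.isOpen_extend_target
  have hs := (((contMDiffOn_extend_symm_target he).contMDiffAt
    (ho.mem_nhds hz)).mdifferentiableAt (by simp)).hasMFDerivAt
  have hs₁ := (((contMDiffOn_extend_symm_target he₁).contMDiffAt
    (e₁.isOpen_extend_target.mem_nhds h₁)).mdifferentiableAt (by simp)).hasMFDerivAt
  have hs₂ := (((contMDiffOn_extend_symm_target he₂).contMDiffAt
    (e₂.isOpen_extend_target.mem_nhds h₂)).mdifferentiableAt (by simp)).hasMFDerivAt
  -- The same map differentiated in two ways: projection after inverse product chart, and inverse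
  -- factor chart after projection.
  have k₁ := hasMFDerivAt_unique
    ((hasMFDerivAt_fst (I := 𝓘(ℝ, E₁)) (I' := 𝓘(ℝ, E₂)) _).comp z hs)
    (hs₁.comp z (ContinuousLinearMap.fst ℝ E₁ E₂).hasMFDerivAt)
  have k₂ := hasMFDerivAt_unique
    ((hasMFDerivAt_snd (I := 𝓘(ℝ, E₁)) (I' := 𝓘(ℝ, E₂)) _).comp z hs)
    (hs₂.comp z (ContinuousLinearMap.snd ℝ E₁ E₂).hasMFDerivAt)
  -- Tangent spaces are replaced by the model spaces they unfold to, so that the remaining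
  -- identities are between plain linear maps.
  let p := ((e₁.prod e₂).extend (𝓘(ℝ, E₁).prod 𝓘(ℝ, E₂))).symm z
  let L : E₁ × E₂ →L[ℝ] E₁ × E₂ := mfderiv 𝓘(ℝ, E₁ × E₂) (𝓘(ℝ, E₁).prod 𝓘(ℝ, E₂))
    ((e₁.prod e₂).extend (𝓘(ℝ, E₁).prod 𝓘(ℝ, E₂))).symm z
  let D₁ : E₁ →L[ℝ] E₁ := mfderiv 𝓘(ℝ, E₁) 𝓘(ℝ, E₁) (e₁.extend 𝓘(ℝ, E₁)).symm z.1
  let D₂ : E₂ →L[ℝ] E₂ := mfderiv 𝓘(ℝ, E₂) 𝓘(ℝ, E₂) (e₂.extend 𝓘(ℝ, E₂)).symm z.2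
  have l₁ : ∀ x : E₁ × E₂, (L x).1 = D₁ x.1 := fun x => DFunLike.congr_fun k₁ x
  have l₂ : ∀ x : E₁ × E₂, (L x).2 = D₂ x.2 := fun x => DFunLike.congr_fun k₂ x
  let B₁ : E₁ →L[ℝ] E₁ →L[ℝ] ℝ := g₁ p.1
  let B₂ : E₂ →L[ℝ] E₂ →L[ℝ] ℝ := g₂ p.2
  have hfst : (mfderiv (𝓘(ℝ, E₁).prod 𝓘(ℝ, E₂)) 𝓘(ℝ, E₁) (Prod.fst : M₁ × M₂ → M₁) p :
      E₁ × E₂ →L[ℝ] E₁) = ContinuousLinearMap.fst ℝ E₁ E₂ := mfderiv_fst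
  have hsnd : (mfderiv (𝓘(ℝ, E₁).prod 𝓘(ℝ, E₂)) 𝓘(ℝ, E₂) (Prod.snd : M₁ × M₂ → M₂) p :
      E₁ × E₂ →L[ℝ] E₂) = ContinuousLinearMap.snd ℝ E₁ E₂ := mfderiv_snd
  have key : inChart (𝓘(ℝ, E₁).prod 𝓘(ℝ, E₂))
        (doublyWarpedMetric 𝓘(ℝ, E₁) 𝓘(ℝ, E₂) g₁ g₂ f₁ f₂) (e₁.prod e₂) z v w
      = f₂ p.2 ^ 2 * LocalMetric.pullback B₁ (mfderiv (𝓘(ℝ, E₁).prod 𝓘(ℝ, E₂)) 𝓘(ℝ, E₁)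
          (Prod.fst : M₁ × M₂ → M₁) p : E₁ × E₂ →L[ℝ] E₁) (L v) (L w)
        + f₁ p.1 ^ 2 * LocalMetric.pullback B₂ (mfderiv (𝓘(ℝ, E₁).prod 𝓘(ℝ, E₂)) 𝓘(ℝ, E₂)
          (Prod.snd : M₁ × M₂ → M₂) p : E₁ × E₂ →L[ℝ] E₂) (L v) (L w) := rfl
  have e₁' : inChart 𝓘(ℝ, E₁) g₁ e₁ z.1 v.1 w.1 = B₁ (D₁ v.1) (D₁ w.1) := rfl
  have e₂' : inChart 𝓘(ℝ, E₂) g₂ e₂ z.2 v.2 w.2 = B₂ (D₂ v.2) (D₂ w.2) := rfl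
  rw [key, hfst, hsnd, e₁', e₂', ← l₁, ← l₁, ← l₂, ← l₂]
  rfl

/-! ### Consequences of the chart expressions -/

theorem isClassIB_iff {E : Type*} [NormedAddCommGroup E] [NormedSpace ℝ E]
    [FiniteDimensional ℝ E] {H : Type*} [TopologicalSpace H] (I : ModelWithCorners ℝ E H)
    {M : Type*} [TopologicalSpace M] [ChartedSpace H M] (g : BilinField I M) :
    IsClassIB I g ↔ ∀ e ∈ IsManifold.maximalAtlas I ∞ M, ∀ y ∈ (e.extend I).target, ∀ u v w : E,
      LocalMetric.codazziDefect (inChart I g e) y u v w = 0 := by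
  simp only [IsClassIB, LocalMetric.codazziDefect, sub_eq_zero]

/-- `E × F` as the direct sum of its factors. -/
def LocalMetric.Splitting.prod (E F : Type*) [NormedAddCommGroup E] [NormedSpace ℝ E]
    [NormedAddCommGroup F] [NormedSpace ℝ F] : LocalMetric.Splitting (E × F) E F where
  p := ContinuousLinearMap.fst ℝ E F
  p' := ContinuousLinearMap.snd ℝ E F
  i := ContinuousLinearMap.inl ℝ E F
  i' := ContinuousLinearMap.inr ℝ E F
  p_i _ := rfl
  p'_i' _ := rfl
  p_i' _ := rfl
  p'_i _ := rfl
  add_eq v := by simp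

/-- The direct sum with the two summands exchanged. -/
def LocalMetric.Splitting.swap {E F F' : Type*} [NormedAddCommGroup E] [NormedSpace ℝ E]
    [NormedAddCommGroup F] [NormedSpace ℝ F] [NormedAddCommGroup F'] [NormedSpace ℝ F']
    (s : LocalMetric.Splitting E F F') : LocalMetric.Splitting E F' F where
  p := s.p'
  p' := s.p
  i := s.i'
  i' := s.i
  p_i := s.p'_i'
  p'_i' := s.p_i
  p_i' := s.p'_i
  p'_i := s.p_i'
  add_eq v := by rw [add_comm, s.add_eq]

end

theorem mainTheorem4
    {E₁ : Type*} [NormedAddCommGroup E₁] [NormedSpace ℝ E₁] [FiniteDimensional ℝ E₁]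
    {M₁ : Type*} [TopologicalSpace M₁] [ChartedSpace E₁ M₁] [IsManifold 𝓘(ℝ, E₁) ∞ M₁]
    [Nonempty M₁]
    {E₂ : Type*} [NormedAddCommGroup E₂] [NormedSpace ℝ E₂] [FiniteDimensional ℝ E₂]
    {M₂ : Type*} [TopologicalSpace M₂] [ChartedSpace E₂ M₂] [IsManifold 𝓘(ℝ, E₂) ∞ M₂]
    [Nonempty M₂]
    (g₁ : BilinField 𝓘(ℝ, E₁) M₁) (hg₁ : IsPseudoRiemannianMetric 𝓘(ℝ, E₁) g₁)
    (g₂ : BilinField 𝓘(ℝ, E₂) M₂) (hg₂ : IsPseudoRiemannianMetric 𝓘(ℝ, E₂) g₂)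
    (f₁ : M₁ → ℝ) (hf₁ : ContMDiff 𝓘(ℝ, E₁) 𝓘(ℝ, ℝ) ∞ f₁) (hf₁_pos : ∀ x, 0 < f₁ x)
    (f₂ : M₂ → ℝ) (hf₂ : ContMDiff 𝓘(ℝ, E₂) 𝓘(ℝ, ℝ) ∞ f₂) (hf₂_pos : ∀ x, 0 < f₂ x)
    (hM : IsClassIB (𝓘(ℝ, E₁).prod 𝓘(ℝ, E₂))
      (doublyWarpedMetric 𝓘(ℝ, E₁) 𝓘(ℝ, E₂) g₁ g₂ f₁ f₂))
    (hφ : GradientAnnihilatesWeyl (𝓘(ℝ, E₁).prod 𝓘(ℝ, E₂))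
      (doublyWarpedMetric 𝓘(ℝ, E₁) 𝓘(ℝ, E₂) g₁ g₂ f₁ f₂)
      (fun p : M₁ × M₂ => f₁ p.1 * f₂ p.2)) :
    (HasConstantScalarCurvature 𝓘(ℝ, E₁) (conformalChange 𝓘(ℝ, E₁) g₁ f₁) →
      (IsClassIB 𝓘(ℝ, E₁) g₁ ↔ GradientAnnihilatesWeyl 𝓘(ℝ, E₁) g₁ f₁)) ∧
    (HasConstantScalarCurvature 𝓘(ℝ, E₂) (conformalChange 𝓘(ℝ, E₂) g₂ f₂) →
      (IsClassIB 𝓘(ℝ, E₂) g₂ ↔ GradientAnnihilatesWeyl 𝓘(ℝ, E₂) g₂ f₂)) := by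
  rw [isClassIB_iff] at hM
  have hprod : ∀ e₁ ∈ IsManifold.maximalAtlas 𝓘(ℝ, E₁) ∞ M₁,
      ∀ e₂ ∈ IsManifold.maximalAtlas 𝓘(ℝ, E₂) ∞ M₂, ∀ y₁ ∈ (e₁.extend 𝓘(ℝ, E₁)).target,
      ∀ y₂ ∈ (e₂.extend 𝓘(ℝ, E₂)).target,
      (y₁, y₂) ∈ ((e₁.prod e₂).extend (𝓘(ℝ, E₁).prod 𝓘(ℝ, E₂))).target := by
    intro e₁ he₁ e₂ he₂ y₁ hy₁ y₂ hy₂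
    rw [OpenPartialHomeomorph.extend_prod]
    exact ⟨hy₁, hy₂⟩
  constructor
  · rintro ⟨c, hc⟩
    rw [isClassIB_iff, GradientAnnihilatesWeyl]
    refine forall₂_congr fun e₁ he₁ => forall₂_congr fun y₁ hy₁ => ?_
    -- One point of the other factor suffices: the local equivalence is applied at `(y₁, y₂)`, with
    -- `y₂` the image of `x₂`, and its two sides involve only `y₁`.
    obtain ⟨x₂⟩ := ‹Nonempty M₂›
    have he₂ := IsManifold.chart_mem_maximalAtlas (I := 𝓘(ℝ, E₂)) (n := ∞) x₂
    have hy₂ := mem_extChartAt_target (I := 𝓘(ℝ, E₂)) x₂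
    have hy := hprod e₁ he₁ _ he₂ y₁ hy₁ _ hy₂
    exact LocalMetric.codazziDefect_eq_zero_iff_of_doublyWarped
      (s := LocalMetric.Splitting.prod E₁ E₂) (y := (y₁, _))
      (hg₁.isMetricOn_inChart he₁) (hg₂.isMetricOn_inChart he₂)
      (contDiffOn_comp_extend_symm he₁ hf₁) (fun z _ => hf₁_pos _)
      (contDiffOn_comp_extend_symm he₂ hf₂) (fun z _ => hf₂_pos _)
      (fun z h₁ h₂ v w => inChart_doublyWarpedMetric g₁ g₂ f₁ f₂ he₁ he₂ h₁ h₂ v w)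
      hy₁ hy₂ (hM _ (IsManifold.mem_maximalAtlas_prod he₁ he₂) _ hy)
      (hφ _ (IsManifold.mem_maximalAtlas_prod he₁ he₂) _ hy) (fun z hz => hc e₁ he₁ z hz)
  · rintro ⟨c, hc⟩
    rw [isClassIB_iff, GradientAnnihilatesWeyl]
    refine forall₂_congr fun e₂ he₂ => forall₂_congr fun y₂ hy₂ => ?_
    obtain ⟨x₁⟩ := ‹Nonempty M₁›
    have he₁ := IsManifold.chart_mem_maximalAtlas (I := 𝓘(ℝ, E₁)) (n := ∞) x₁
    have hy₁ := mem_extChartAt_target (I := 𝓘(ℝ, E₁)) x₁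
    have hy := hprod _ he₁ e₂ he₂ _ hy₁ y₂ hy₂
    -- With the factors exchanged, the local statement expects the product as `f₂ f₁`.
    simp only [mul_comm (f₁ _)] at hφ
    exact LocalMetric.codazziDefect_eq_zero_iff_of_doublyWarped
      (s := (LocalMetric.Splitting.prod E₁ E₂).swap) (y := (_, y₂))
      (hg₂.isMetricOn_inChart he₂) (hg₁.isMetricOn_inChart he₁)
      (contDiffOn_comp_extend_symm he₂ hf₂) (fun z _ => hf₂_pos _)
      (contDiffOn_comp_extend_symm he₁ hf₁) (fun z _ => hf₁_pos _)
      (fun z h₂ h₁ v w =>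
        (inChart_doublyWarpedMetric g₁ g₂ f₁ f₂ he₁ he₂ h₁ h₂ v w).trans (add_comm _ _))
      hy₂ hy₁ (hM _ (IsManifold.mem_maximalAtlas_prod he₁ he₂) _ hy)
      (hφ _ (IsManifold.mem_maximalAtlas_prod he₁ he₂) _ hy) (fun z hz => hc e₂ he₂ z hz)
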